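/- Let $M$ be a closed surface (a compact Hausdorff smooth $2$-manifold without boundary) with a continuous Riemannian metric, and let $\mathrm{End}^1(M)$ be the space of $C^1$ maps $M\to M$ with the $C^1$ topology. For $f\in\mathrm{End}^1(M)$ let $\mathrm{Cr}(f)$ be the set of points $x$ at which $Df_x$ is not an isomorphism, and let $M_f=\{(x_i)_{i\in\mathbb Z}\in M^{\mathbb Z}: f(x_i)=x_{i+1}\ \forall i\in\mathbb{Z}\}$ be the space of full orbits, with the product topology. We say that $f$ *admits a dominated splitting* if there are $\alpha>0$, an integer $\ell\ge 1$ and two continuous one-dimensional subbundles $E,F$ of the pullback of $TM$ to $M_f$ under $(x_i)_i\mapsto x_0$ such that for every $(x_i)_i\in M_f$ and $i\in\mathbb Z$, writing $E(x_i),F(x_i)\subset T_{x_i}M$ for the fibres of $E$, $F$ at the shifted orbit $(x_{i+j})_{j}$: * $Df(E(x_i))\subseteq E(x_{i+1})$, $Df(F(x_i))=F(x_{i+1})$ and $T_{x_i}M=E(x_i)\oplus F(x_i)$; * $\angle(E(x_i),F(x_i))\ge\alpha$; * $\|Df^\ell|_{E(x_i)}\|\le\frac12\|Df^\ell|_{F(x_i)}\|$.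 We say that $g\in\mathrm{End}^1(M)$ *has full-dimensional kernel* if there are $n\ge1$ and $x\in\mathrm{Cr}(g)$ with $\dim\ker Dg^n_x=2$ (that is, $Dg^n_x=0$). **Theorem.** Let $f\in\mathrm{End}^1(M)$ be transitive (some forward orbit is dense in $M$), suppose that $\mathrm{Cr}(f)$ has nonempty interior, and suppose that $\max_{x\in M}\dim\ker Df^n_x=1$ for every $n\ge1$. Then either $f$ admits a dominated splitting, or $f$ is a limit in the $C^1$ topology of endomorphisms $g\in\mathrm{End}^1(M)$ having full-dimensional kernel. -/

import Mathlib

open scoped Manifold ContDiff Topology Bundle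
open Set Module

noncomputable section

namespace SurfaceEndo

/- `M` is a smooth surface without boundary: it is modelled on `EuclideanSpace ℝ (Fin 2)` through
the boundaryless model `𝓡 2`. Compactness, the Hausdorff property and the Riemannian metric are
assumed where they are needed. -/
variable (M : Type*) [TopologicalSpace M] [ChartedSpace (EuclideanSpace ℝ (Fin 2)) M]

/-- `End¹(M)`: the `C¹` maps from `M` into itself. -/
abbrev End1 : Type _ := ContMDiffMap (𝓡 2) (𝓡 2) M M 1

variable {M}

/-- The tangent map `Tf : TM → TM` of a `C¹` map, as a continuous map. -/
def tangentMapC [IsManifold (𝓡 2) ∞ M] (f : End1 M) :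
    C(TangentBundle (𝓡 2) M, TangentBundle (𝓡 2) M) :=
  ⟨tangentMap (𝓡 2) (𝓡 2) f, f.contMDiff.continuous_tangentMap le_rfl⟩

/-- The `C¹` topology on `End¹(M)`: uniform convergence on compact sets of a map together with its
derivative, that is, the topology induced by `f ↦ Tf` from the compact-open topology on the
continuous maps `TM → TM`. -/
instance c1Topology [IsManifold (𝓡 2) ∞ M] : TopologicalSpace (End1 M) :=
  TopologicalSpace.induced tangentMapC ContinuousMap.compactOpen

/-- The derivative `Df^n_x : T_x M → T_{f^n(x)} M` of the `n`-th iterate. -/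
abbrev derivIter (f : M → M) (n : ℕ) (x : M) :
    TangentSpace (𝓡 2) x →L[ℝ] TangentSpace (𝓡 2) (f^[n] x) :=
  mfderiv (𝓡 2) (𝓡 2) f^[n] x

/-- The set `Cr(f)` of critical points: those where the derivative is not an isomorphism. -/
def criticalSet (f : End1 M) : Set M :=
  {x | ¬ (mfderiv (𝓡 2) (𝓡 2) f x).IsInvertible}

/-- `f` is transitive: some forward orbit is dense in `M`. -/
def IsTransitive (f : End1 M) : Prop :=
  ∃ x : M, Dense (range fun n : ℕ => f^[n] x)

/-- The dimension of `ker Df^n_x`. -/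
def kerDim (f : End1 M) (n : ℕ) (x : M) : ℕ :=
  finrank ℝ (LinearMap.ker (derivIter f n x).toLinearMap)

/-- `f` has full-dimensional kernel: `dim ker Df^n_x = dim M = 2` for some `n ≥ 1` and some
critical point `x`. -/
def HasFullDimensionalKernel (f : End1 M) : Prop :=
  ∃ n : ℕ, 1 ≤ n ∧ ∃ x ∈ criticalSet f, kerDim f n x = 2

/-- `M_f`: the space of all full orbits `(x_i)_{i ∈ ℤ}` of `f`, a subspace of `M^ℤ`. -/
abbrev OrbitSpace (f : End1 M) : Type _ := {x : ℤ → M // ∀ i, f (x i) = x (i + 1)}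

/-- The action of `f` on `M_f`, the shift `(x_i)_i ↦ (x_{i+1})_i`; it is written as
`(x_i)_i ↦ (f(x_i))_i` (see `shift_apply`), so that the zeroth entry of the image is literally
`f(x_0)`. -/
def shift (f : End1 M) (x : OrbitSpace f) : OrbitSpace f :=
  ⟨fun i => f (x.1 i), fun i => congrArg f (x.2 i)⟩

theorem shift_apply (f : End1 M) (x : OrbitSpace f) (i : ℤ) : (shift f x).1 i = x.1 (i + 1) :=
  x.2 i

/-- A family of subspaces `E(x) ⊆ T_{x_0} M`, `x = (x_i)_i ∈ M_f`, is a one-dimensional subbundle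
of `TM_f` (the pullback of `TM` by `(x_i)_i ↦ x_0`): locally it is spanned by a continuous nowhere
vanishing section. -/
def IsLineSubbundle [IsManifold (𝓡 2) ∞ M] (f : End1 M)
    (E : ∀ x : OrbitSpace f, Submodule ℝ (TangentSpace (𝓡 2) (x.1 0))) : Prop :=
  ∀ x₀ : OrbitSpace f, ∃ U ∈ 𝓝 x₀, ∃ σ : ∀ x : OrbitSpace f, TangentSpace (𝓡 2) (x.1 0),
    ContinuousOn (fun x => (⟨x.1 0, σ x⟩ : TangentBundle (𝓡 2) M)) U ∧
      ∀ x ∈ U, σ x ≠ 0 ∧ E x = Submodule.span ℝ {σ x}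

/-- `f` admits a dominated splitting over the whole orbit space `M_f`. As `M_f` is invariant under
the shift, asking each property at the zeroth entry of every orbit is the same as asking it at every
entry `x_i` of every orbit. The angle between two lines is the smallest angle between nonzero
vectors of the two. -/
def HasDominatedSplitting [IsManifold (𝓡 2) ∞ M]
    [Bundle.RiemannianBundle (fun x : M => TangentSpace (𝓡 2) x)] (f : End1 M) : Prop :=
  ∃ (α : ℝ) (ℓ : ℕ) (E F : ∀ x : OrbitSpace f, Submodule ℝ (TangentSpace (𝓡 2) (x.1 0))),
    0 < α ∧ 1 ≤ ℓ ∧ IsLineSubbundle f E ∧ IsLineSubbundle f F ∧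
    ∀ x : OrbitSpace f,
      -- invariant splitting
      (E x).map (mfderiv (𝓡 2) (𝓡 2) f (x.1 0)).toLinearMap ≤ E (shift f x) ∧
      (F x).map (mfderiv (𝓡 2) (𝓡 2) f (x.1 0)).toLinearMap = F (shift f x) ∧
      IsCompl (E x) (F x) ∧
      -- uniform angle
      (∀ u ∈ E x, ∀ v ∈ F x, u ≠ 0 → v ≠ 0 → α ≤ InnerProductGeometry.angle u v) ∧
      -- domination
      ‖(derivIter f ℓ (x.1 0)).comp (E x).subtypeL‖ ≤
        1 / 2 * ‖(derivIter f ℓ (x.1 0)).comp (F x).subtypeL‖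

end SurfaceEndo

end

/-!
If `f` is not a limit of maps with full-dimensional kernel, a dominated splitting is built along a
dense forward orbit `z n = f^n (x₀)` and then carried to all full orbits by taking limits.

*Perturbations.* By a Franks-type lemma (`exists_perturbation_id`), maps which are `C¹` close to the
identity can fix any finite set of points and have there any derivatives close to the identity; the
closeness required does not depend on the number of points, because the perturbations have disjoint
supports. Composing `f` with such a map replaces `Df` at `z i` by `Df ∘ (1 + P i)`, where the `P i`
are arbitrary and small. As `f` is not a limit of maps with full-dimensional kernel, no product of
these perturbed derivatives along the orbit vanishes (`exists_stablyNonzero`).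

*Linear algebra.* The dense orbit visits the interior of `Cr(f)` infinitely often. So for large `n`
some nonzero vectors of `T_{z n} M` are killed by an iterate of `Df`, and the image of `Df^n` in
`T_{z n} M` is not the whole plane; as no product vanishes, these vectors form a line `E n` and the
image is a line `F n`. Since no small perturbation can send `F` into `E`, the lines `E n` and `F n`
are not too close (`StablyNonzero.exists_frame`), and `F` uniformly dominates `E`: otherwise small
dilations of `E`, repeated along a long piece of orbit, would bring the image of a line next to `F`
close to `E` (`StablyNonzero.exists_dominated_frame`).

*Limits.* Every full orbit is a limit of pieces of the forward orbit, and unit vectors spanning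
`E` and `F` along these pieces have limits, which inherit the angle and domination estimates
(`exists_limit_frame`, `exists_frame_of_forwardOrbit`). The domination and the nonvanishing of all
`Df^n` make the two limit lines unique (`exists_eq_smul_e`, `exists_eq_smul_u`), and uniqueness
gives both their invariance and, as limits of limit lines are again such lines, their continuity
(`isLineSubbundle_of_frames`).
-/

noncomputable section

namespace SurfaceEndo

/-! ### Sequences of linear maps between planes -/

section LinearCocycle

/-- For two unit vectors whose angle is bounded away from `0` and `π`, the first coordinate in
the basis they form has controlled norm. -/
theorem exists_coord_norm_le {V : Type*} [NormedAddCommGroup V] [InnerProductSpace ℝ V]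
    {e f : V} {δ : ℝ} (hδ : 0 < δ) (he : ‖e‖ = 1) (hf : ‖f‖ = 1)
    (hef : inner ℝ e f ^ 2 ≤ 1 - δ ^ 2) :
    ∃ φ : V →L[ℝ] ℝ, φ e = 1 ∧ φ f = 0 ∧ ‖φ‖ ≤ 1 / δ := by
  set c : ℝ := inner ℝ e f with hc
  have hpos : 0 < 1 - c ^ 2 := by nlinarith [sq_pos_of_pos hδ]
  have hee : inner ℝ e e = (1 : ℝ) := by rw [real_inner_self_eq_norm_sq, he]; norm_num
  have hff : inner ℝ f f = (1 : ℝ) := by rw [real_inner_self_eq_norm_sq, hf]; norm_num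
  have hfe : inner ℝ f e = c := by rw [real_inner_comm]
  have hn : ‖e - c • f‖ ^ 2 = 1 - c ^ 2 := by
    rw [← real_inner_self_eq_norm_sq]
    simp only [inner_sub_left, inner_sub_right, inner_smul_left, inner_smul_right, hee, hff, hfe,
      ← hc, RCLike.conj_to_real]
    ring
  refine ⟨(1 - c ^ 2)⁻¹ • innerSL ℝ (e - c • f), ?_, ?_, ?_⟩
  · simp only [smul_apply, innerSL_apply_apply, inner_sub_left,
      inner_smul_left, hee, hfe, RCLike.conj_to_real, smul_eq_mul]
    field_simp
  · simp only [smul_apply, innerSL_apply_apply, inner_sub_left,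
      inner_smul_left, hff, ← hc, RCLike.conj_to_real, smul_eq_mul]
    ring
  · rw [norm_smul, innerSL_apply_norm, norm_inv, Real.norm_of_nonneg hpos.le, ← hn]
    have h1 : δ ≤ ‖e - c • f‖ := by
      refine le_of_sq_le_sq ?_ (norm_nonneg _)
      rw [hn]; linarith
    have h2 : 0 < ‖e - c • f‖ := hδ.trans_le h1
    calc (‖e - c • f‖ ^ 2)⁻¹ * ‖e - c • f‖ = 1 / ‖e - c • f‖ := by field_simp
      _ ≤ 1 / δ := one_div_le_one_div_of_le hδ h1

theorem eq_span_singleton_of_finrank_two {V : Type*} [AddCommGroup V] [Module ℝ V]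
    (hV : finrank ℝ V = 2) {W : Submodule ℝ V} (hW : W ≠ ⊤) {v : V} (hv : v ≠ 0) (hvW : v ∈ W) :
    W = Submodule.span ℝ {v} := by
  have : FiniteDimensional ℝ V := .of_finrank_pos (by omega)
  have h1 : finrank ℝ W < 2 := hV ▸ Submodule.finrank_lt hW
  refine (Submodule.eq_of_le_of_finrank_le ?_ ?_).symm
  · rwa [Submodule.span_singleton_le_iff_mem]
  · rw [finrank_span_singleton hv]; omega

theorem exists_norm_eq_one_mem {V : Type*} [NormedAddCommGroup V] [NormedSpace ℝ V]
    {W : Submodule ℝ V} (hW : W ≠ ⊥) : ∃ v ∈ W, ‖v‖ = 1 := by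
  obtain ⟨v, hv, hv0⟩ := W.exists_mem_ne_zero_of_ne_bot hW
  exact ⟨‖v‖⁻¹ • v, W.smul_mem _ hv, norm_smul_inv_norm (𝕜 := ℝ) hv0⟩

variable {T : ℕ → Type*} [∀ n, NormedAddCommGroup (T n)] [∀ n, InnerProductSpace ℝ (T n)]
  (A : ∀ n, T n →L[ℝ] T (n + 1))

/-- The kernel of the product `A (n + k - 1) ∘ ⋯ ∘ A n`. -/
def kerIn : ℕ → ∀ n, Submodule ℝ (T n)
  | 0, _ => ⊥
  | k + 1, n => (kerIn k (n + 1)).comap (A n).toLinearMap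

/-- The space of vectors which are eventually sent to `0` by the sequence `A`. -/
def eventualKer (n : ℕ) : Submodule ℝ (T n) := ⨆ k, kerIn A k n

/-- The range of the product `A (n - 1) ∘ ⋯ ∘ A 0`. -/
def rangeFrom : ∀ n, Submodule ℝ (T n)
  | 0 => ⊤
  | n + 1 => (rangeFrom n).map (A n).toLinearMap

/-- `w` is an orbit of the sequence of maps `A i ∘ (1 + P i)`. -/
def IsPerturbedOrbit (P : ∀ i, T i →L[ℝ] T i) (w : ∀ i, T i) : Prop :=
  ∀ i, w (i + 1) = A i (w i + P i (w i))

/-- No product of the maps `A i ∘ (1 + P i)` with `‖P i‖ ≤ δ`, starting at the index `0`,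
vanishes. -/
def StablyNonzero (δ : ℝ) : Prop :=
  ∀ P : ∀ i, T i →L[ℝ] T i, (∀ i, ‖P i‖ ≤ δ) → ∀ m, ∃ w, IsPerturbedOrbit A P w ∧ w m ≠ 0

variable {A}

theorem kerIn_le_succ (k n : ℕ) : kerIn A k n ≤ kerIn A (k + 1) n := by
  induction k generalizing n with
  | zero => exact bot_le
  | succ k ih => exact Submodule.comap_mono (ih (n + 1))

theorem monotone_kerIn (n : ℕ) : Monotone fun k => kerIn A k n :=
  monotone_nat_of_le_succ fun k => kerIn_le_succ k n

theorem mem_eventualKer {n : ℕ} {v : T n} : v ∈ eventualKer A n ↔ ∃ k, v ∈ kerIn A k n :=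
  Submodule.mem_iSup_of_directed _ (monotone_kerIn n).directed_le

theorem map_mem_eventualKer {n : ℕ} {v : T n} :
    A n v ∈ eventualKer A (n + 1) ↔ v ∈ eventualKer A n := by
  simp only [mem_eventualKer]
  exact ⟨fun ⟨k, hk⟩ => ⟨k + 1, hk⟩, fun ⟨k, hk⟩ => ⟨k, kerIn_le_succ k n hk⟩⟩

theorem exists_eventualKer_le_kerIn (hdim : ∀ n, finrank ℝ (T n) = 2) (n : ℕ) :
    ∃ k, eventualKer A n ≤ kerIn A k n := by
  have : FiniteDimensional ℝ (T n) := .of_finrank_pos (by rw [hdim]; norm_num)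
  obtain ⟨k, hk⟩ := monotone_stabilizes_iff_noetherian.2 (inferInstance : IsNoetherian ℝ (T n))
    ⟨fun k => kerIn A k n, monotone_kerIn n⟩
  refine ⟨k, iSup_le fun j => ?_⟩
  rcases le_total k j with h | h
  · exact (hk j h).ge
  · exact monotone_kerIn n h

theorem IsPerturbedOrbit.eq_zero_of_mem_kerIn {P : ∀ i, T i →L[ℝ] T i} {w : ∀ i, T i}
    (hw : IsPerturbedOrbit A P w) {k m : ℕ} (hP : ∀ i, m ≤ i → P i = 0) (hm : w m ∈ kerIn A k m)
    {i : ℕ} (hi : m + k ≤ i) : w i = 0 := by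
  induction k generalizing m with
  | zero =>
    have h0 : w m = 0 := hm
    obtain ⟨j, rfl⟩ := Nat.exists_eq_add_of_le hi
    clear hi
    induction j with
    | zero => exact h0
    | succ j ih =>
      have := hw (m + 0 + j)
      rw [ih, map_zero, zero_add, map_zero] at this
      exact this
  | succ k ih =>
    refine ih (m := m + 1) (fun i hi => hP i (by omega)) ?_ (by omega)
    rw [hw m, hP m le_rfl, zero_apply, add_zero]
    exact hm

theorem IsPerturbedOrbit.mem_rangeFrom {P : ∀ i, T i →L[ℝ] T i} {w : ∀ i, T i}
    (hw : IsPerturbedOrbit A P w) {n : ℕ} (hP : ∀ i, i < n → P i = 0) : w n ∈ rangeFrom A n := by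
  induction n with
  | zero => trivial
  | succ n ih =>
    refine ⟨w n, ih fun i hi => hP i (by omega), ?_⟩
    rw [hw n, hP n (by omega)]
    simp

/-- The form in which stability is used: a small perturbation supported in `[n, m)` cannot send
the range of the past into the kernel of the future. -/
theorem StablyNonzero.exists_orbit {δ : ℝ} (H : StablyNonzero A δ)
    (hdim : ∀ n, finrank ℝ (T n) = 2) {P : ∀ i, T i →L[ℝ] T i} (hP : ∀ i, ‖P i‖ ≤ δ) {n m : ℕ}
    (hn : ∀ i, i < n → P i = 0) (hm : ∀ i, m ≤ i → P i = 0) :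
    ∃ w, IsPerturbedOrbit A P w ∧ w n ∈ rangeFrom A n ∧ w m ∉ eventualKer A m := by
  obtain ⟨k, hk⟩ := exists_eventualKer_le_kerIn (A := A) hdim m
  obtain ⟨w, hw, hw0⟩ := H P hP (m + k)
  exact ⟨w, hw, hw.mem_rangeFrom hn,
    fun h => hw0 (hw.eq_zero_of_mem_kerIn hm (hk h) le_rfl)⟩

theorem rangeFrom_ne_top (hdim : ∀ n, finrank ℝ (T n) = 2) {m n : ℕ} (hmn : m < n)
    (hm : ∃ v, v ≠ 0 ∧ A m v = 0) : rangeFrom A n ≠ ⊤ := by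
  have hfin (n) : FiniteDimensional ℝ (T n) := .of_finrank_pos (by rw [hdim]; norm_num)
  suffices finrank ℝ (rangeFrom A n) < 2 by
    intro h
    rw [h, finrank_top, hdim] at this
    omega
  induction n, hmn using Nat.le_induction with
  | base =>
    obtain ⟨v, hv, hv0⟩ := hm
    have h1 : finrank ℝ (rangeFrom A (m + 1)) ≤ finrank ℝ (LinearMap.range (A m).toLinearMap) :=
      Submodule.finrank_mono (LinearMap.map_le_range)
    have h2 := (A m).toLinearMap.finrank_range_add_finrank_ker
    have h3 : 0 < finrank ℝ (LinearMap.ker (A m).toLinearMap) := by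
      refine Submodule.one_le_finrank_iff.2 fun h => hv ?_
      have : v ∈ LinearMap.ker (A m).toLinearMap := hv0
      rwa [h, Submodule.mem_bot] at this
    rw [hdim] at h2
    change finrank ℝ (rangeFrom A (m + 1)) < 2
    omega
  | succ n _ ih => exact (Submodule.finrank_map_le _ _).trans_lt ih

/-- Under stability, beyond the first singular index the range of the past and the kernel of the
future are two lines making an angle bounded from below, since a rank one perturbation moves the
first line into the second as soon as the two are close. -/
theorem StablyNonzero.exists_frame {δ : ℝ} (hδ : 0 < δ) (H : StablyNonzero A δ)
    (hdim : ∀ n, finrank ℝ (T n) = 2) (hsing : ∀ N, ∃ n, N ≤ n ∧ ∃ v, v ≠ 0 ∧ A n v = 0) :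
    ∃ (N : ℕ) (e f : ∀ n, T n), ∀ n, N ≤ n → ‖e n‖ = 1 ∧ ‖f n‖ = 1 ∧
      inner ℝ (e n) (f n) ^ 2 ≤ 1 - δ ^ 2 ∧
      eventualKer A n = Submodule.span ℝ {e n} ∧ rangeFrom A n = Submodule.span ℝ {f n} := by
  obtain ⟨m, -, hm⟩ := hsing 0
  have hz : ∀ n, ∃ w, IsPerturbedOrbit A 0 w ∧ w n ∈ rangeFrom A n ∧ w n ∉ eventualKer A n :=
    fun n => H.exists_orbit hdim (by simpa using hδ.le) (fun _ _ => rfl) (fun _ _ => rfl)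
  have hker : ∀ n, eventualKer A n ≠ ⊥ := by
    have key : ∀ j n, (∃ v, v ≠ 0 ∧ A (n + j) v = 0) → eventualKer A n ≠ ⊥ := by
      intro j
      induction j with
      | zero =>
        rintro n ⟨v, hv, hv0⟩ h
        have : v ∈ eventualKer A n := mem_eventualKer.2 ⟨1, by simpa [kerIn] using hv0⟩
        rw [h] at this
        exact hv this
      | succ j ih =>
        intro n hv h
        have h1 : eventualKer A (n + 1) ≠ ⊥ :=
          ih (n + 1) (by rwa [show n + 1 + j = n + (j + 1) by ring])
        have hinj : Function.Injective (A n).toLinearMap := by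
          refine LinearMap.ker_eq_bot.1 (eq_bot_iff.2 fun v hv => ?_)
          rw [← h]
          exact mem_eventualKer.2 ⟨1, by simpa [kerIn] using hv⟩
        have hfin (n) : FiniteDimensional ℝ (T n) :=
          .of_finrank_pos (by rw [hdim]; norm_num)
        have hsurj := (LinearMap.injective_iff_surjective_of_finrank_eq_finrank
          (by rw [hdim, hdim])).1 hinj
        obtain ⟨u, hu, hu0⟩ := Submodule.exists_mem_ne_zero_of_ne_bot h1
        obtain ⟨v, rfl⟩ := hsurj u
        have h2 : v ∈ eventualKer A n := map_mem_eventualKer.1 hu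
        rw [h, Submodule.mem_bot] at h2
        exact hu0 (by rw [h2, map_zero])
    intro n
    obtain ⟨i, hi, hv⟩ := hsing n
    obtain ⟨j, rfl⟩ := Nat.exists_eq_add_of_le hi
    exact key j n hv
  have hker' : ∀ n, eventualKer A n ≠ ⊤ := by
    intro n h
    obtain ⟨w, -, -, hw⟩ := hz n
    exact hw (h ▸ Submodule.mem_top)
  have hran : ∀ n, rangeFrom A n ≠ ⊥ := by
    intro n h
    obtain ⟨w, -, hw, hw'⟩ := hz n
    rw [h, Submodule.mem_bot] at hw
    exact hw' (hw ▸ zero_mem _)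
  choose e he he1 using fun n => exists_norm_eq_one_mem (hker n)
  choose f hf hf1 using fun n => exists_norm_eq_one_mem (hran n)
  have hE : ∀ n, eventualKer A n = Submodule.span ℝ {e n} := fun n =>
    eq_span_singleton_of_finrank_two (hdim n) (hker' n)
      (norm_pos_iff.1 (by rw [he1]; exact one_pos)) (he n)
  have hF : ∀ n, m + 1 ≤ n → rangeFrom A n = Submodule.span ℝ {f n} := fun n hn =>
    eq_span_singleton_of_finrank_two (hdim n) (rangeFrom_ne_top hdim hn hm)
      (norm_pos_iff.1 (by rw [hf1]; exact one_pos)) (hf n)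
  refine ⟨m + 1, e, f, fun n hn => ⟨he1 n, hf1 n, ?_, hE n, hF n hn⟩⟩
  by_contra! hlt
  set c : ℝ := inner ℝ (e n) (f n) with hc
  have hff : inner ℝ (f n) (f n) = (1 : ℝ) := by
    rw [real_inner_self_eq_norm_sq, hf1]; norm_num
  -- `1 + Q` sends `f n` to its orthogonal projection `c • e n` on the line of `e n`
  let Q : T n →L[ℝ] T n := (innerSL ℝ (f n)).smulRight (c • e n - f n)
  have hQ : ‖Q‖ ≤ δ := by
    have h1 : ‖c • e n - f n‖ ^ 2 = 1 - c ^ 2 := by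
      rw [norm_sub_sq_real, norm_smul, inner_smul_left, ← hc, he1, hf1, mul_one]
      simp only [Real.norm_eq_abs, sq_abs, RCLike.conj_to_real]
      ring
    rw [ContinuousLinearMap.norm_smulRight_apply, innerSL_apply_norm, hf1, one_mul]
    exact le_of_sq_le_sq (by rw [h1]; linarith) hδ.le
  obtain ⟨w, hw, hwn, hw'⟩ := H.exists_orbit hdim (P := Function.update 0 n Q) (n := n)
    (m := n + 1) (fun i => by
      rcases eq_or_ne i n with rfl | h
      · simpa using hQ
      · simpa [h] using hδ.le)
    (fun i hi => by simp [hi.ne]) (fun i hi => by simp [show i ≠ n by omega])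
  apply hw'
  rw [hF n hn, Submodule.mem_span_singleton] at hwn
  obtain ⟨s, hs⟩ := hwn
  rw [hw n, map_mem_eventualKer]
  have : w n + Function.update (0 : ∀ i, T i →L[ℝ] T i) n Q n (w n) = (s * c) • e n := by
    simp only [← hs, Function.update_self, Q, ContinuousLinearMap.smulRight_apply,
      innerSL_apply_apply, inner_smul_right, hff]
    module
  rw [this]
  exact Submodule.smul_mem _ _ (he n)

/-- Under stability, the range of the past uniformly dominates the kernel of the future. If not,
on a long time interval the second line is contracted at most twice as much as the first one; then
a perturbation which tilts the first line towards the second one at the initial time, and dilates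
the second one slightly at each intermediate time, brings the image of the first line so close to
the second one that a last small perturbation makes them coincide. -/
theorem StablyNonzero.exists_dominated_frame {δ : ℝ} (hδ : 0 < δ) (H : StablyNonzero A δ)
    (hdim : ∀ n, finrank ℝ (T n) = 2) (hsing : ∀ N, ∃ n, N ≤ n ∧ ∃ v, v ≠ 0 ∧ A n v = 0) :
    ∃ (N ℓ : ℕ) (e f : ∀ n, T n) (a b : ℕ → ℝ), 1 ≤ ℓ ∧ ∀ n, N ≤ n → ‖e n‖ = 1 ∧ ‖f n‖ = 1 ∧
      inner ℝ (e n) (f n) ^ 2 ≤ 1 - δ ^ 2 ∧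
      A n (e n) = b n • e (n + 1) ∧ A n (f n) = a n • f (n + 1) ∧
      ∏ i ∈ Finset.Ico n (n + ℓ), |b i| ≤ 1 / 2 * ∏ i ∈ Finset.Ico n (n + ℓ), |a i| := by
  obtain ⟨N, e, f, hN⟩ := H.exists_frame hδ hdim hsing
  have hb : ∀ n, ∃ b : ℝ, N ≤ n → A n (e n) = b • e (n + 1) := by
    intro n
    by_cases hn : N ≤ n
    · have : A n (e n) ∈ eventualKer A (n + 1) := by
        rw [map_mem_eventualKer, (hN n hn).2.2.2.1]
        exact Submodule.mem_span_singleton_self _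
      rw [(hN (n + 1) (by omega)).2.2.2.1, Submodule.mem_span_singleton] at this
      obtain ⟨b, hb⟩ := this
      exact ⟨b, fun _ => hb.symm⟩
    · exact ⟨0, fun h => absurd h hn⟩
  have ha : ∀ n, ∃ a : ℝ, N ≤ n → A n (f n) = a • f (n + 1) := by
    intro n
    by_cases hn : N ≤ n
    · have : A n (f n) ∈ rangeFrom A (n + 1) := by
        refine ⟨f n, ?_, rfl⟩
        rw [(hN n hn).2.2.2.2]
        exact Submodule.mem_span_singleton_self _
      rw [(hN (n + 1) (by omega)).2.2.2.2, Submodule.mem_span_singleton] at this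
      obtain ⟨a, ha⟩ := this
      exact ⟨a, fun _ => ha.symm⟩
    · exact ⟨0, fun h => absurd h hn⟩
  choose b hb using hb
  choose a ha using ha
  -- `φ n` and `ψ n` are the coordinates along `e n` and `f n`
  have hφ : ∀ n, ∃ φ : T n →L[ℝ] ℝ, N ≤ n → φ (e n) = 1 ∧ φ (f n) = 0 ∧ ‖φ‖ ≤ 1 / δ := by
    intro n
    by_cases hn : N ≤ n
    · obtain ⟨φ, h⟩ := exists_coord_norm_le hδ (hN n hn).1 (hN n hn).2.1 (hN n hn).2.2.1
      exact ⟨φ, fun _ => h⟩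
    · exact ⟨0, fun h => absurd h hn⟩
  have hψ : ∀ n, ∃ φ : T n →L[ℝ] ℝ, N ≤ n → φ (f n) = 1 ∧ φ (e n) = 0 ∧ ‖φ‖ ≤ 1 / δ := by
    intro n
    by_cases hn : N ≤ n
    · obtain ⟨φ, h⟩ := exists_coord_norm_le hδ (hN n hn).2.1 (hN n hn).1
        (by rw [real_inner_comm]; exact (hN n hn).2.2.1)
      exact ⟨φ, fun _ => h⟩
    · exact ⟨0, fun h => absurd h hn⟩
  choose φ hφ using hφ
  choose ψ hψ using hψ
  set η : ℝ := δ ^ 2 with hη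
  have hη0 : 0 < η := by positivity
  -- after `ℓ` dilations the last perturbation, of size about `2 / (η (1 + η) ^ ℓ δ)`, is below `δ`
  obtain ⟨ℓ, hℓ⟩ : ∃ ℓ : ℕ, 2 / (δ ^ 2 * η) < (1 + η) ^ ℓ :=
    pow_unbounded_of_one_lt _ (by linarith)
  rw [div_lt_iff₀ (by positivity)] at hℓ
  refine ⟨N, ℓ + 1, e, f, a, b, by omega, fun n hn => ⟨(hN n hn).1, (hN n hn).2.1,
    (hN n hn).2.2.1, hb n hn, ha n hn, ?_⟩⟩
  by_contra! hlt
  set α : ℝ := ∏ i ∈ Finset.Ico n (n + (ℓ + 1)), a i with hα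
  set β : ℝ := ∏ i ∈ Finset.Ico n (n + (ℓ + 1)), b i with hβ
  rw [← Finset.abs_prod, ← Finset.abs_prod, ← hα, ← hβ] at hlt
  -- the second coordinate of the perturbed orbit of `f n` at time `n + ℓ + 1`
  set τ : ℝ := η * (1 + η) ^ ℓ * β with hτ
  have hατ : |α| ≤ δ ^ 2 * |τ| := by
    rw [hτ, abs_mul, abs_of_pos (show 0 < η * (1 + η) ^ ℓ by positivity)]
    have h1 : 2 * |β| ≤ (1 + η) ^ ℓ * (δ ^ 2 * η) * |β| :=
      mul_le_mul_of_nonneg_right hℓ.le (abs_nonneg _)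
    linarith
  have hβ0 : β ≠ 0 := by
    rintro h
    rw [h, abs_zero] at hlt
    linarith [abs_nonneg α]
  have hτ0 : τ ≠ 0 := by positivity
  have hnorm : ∀ {i : ℕ} (χ : T i →L[ℝ] ℝ) (v : T i) (c : ℝ), ‖χ‖ ≤ 1 / δ → ‖v‖ = 1 →
      |c| ≤ δ ^ 2 → ‖c • χ.smulRight v‖ ≤ δ := by
    intro i χ v c h1 h2 h3
    rw [norm_smul, ContinuousLinearMap.norm_smulRight_apply, h2, mul_one, Real.norm_eq_abs]
    calc |c| * ‖χ‖ ≤ δ ^ 2 * (1 / δ) := by gcongr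
      _ = δ := by field_simp
  let P : ∀ i, T i →L[ℝ] T i := fun i =>
    if i = n then η • (ψ i).smulRight (e i)
    else if n < i ∧ i < n + (ℓ + 1) then η • (φ i).smulRight (e i)
    else if i = n + (ℓ + 1) then (-(α / τ)) • (φ i).smulRight (f i)
    else 0
  have hP : ∀ i, ‖P i‖ ≤ δ := by
    intro i
    simp only [P]
    split_ifs with h1 h2 h3
    · exact hnorm _ _ _ (hψ i (by omega)).2.2 (hN i (by omega)).1 (by rw [abs_of_pos hη0])
    · exact hnorm _ _ _ (hφ i (by omega)).2.2 (hN i (by omega)).1 (by rw [abs_of_pos hη0])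
    · refine hnorm _ _ _ (hφ i (by omega)).2.2 (hN i (by omega)).2.1 ?_
      rw [abs_neg, abs_div, div_le_iff₀ (by positivity)]
      exact hατ
    · simpa using hδ.le
  obtain ⟨w, hw, hwn, hwm⟩ := H.exists_orbit hdim hP (n := n) (m := n + (ℓ + 1) + 1)
    (fun i hi => by simp only [P]; split_ifs <;> first | omega | rfl)
    (fun i hi => by simp only [P]; split_ifs <;> first | omega | rfl)
  apply hwm
  rw [(hN n hn).2.2.2.2, Submodule.mem_span_singleton] at hwn
  obtain ⟨s, hs⟩ := hwn
  have key : ∀ j, j ≤ ℓ → w (n + (j + 1)) =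
      (s * ∏ i ∈ Finset.Ico n (n + (j + 1)), a i) • f (n + (j + 1)) +
      (s * (η * (1 + η) ^ j * ∏ i ∈ Finset.Ico n (n + (j + 1)), b i)) • e (n + (j + 1)) := by
    intro j
    induction j with
    | zero =>
      intro _
      have h1 := hw n
      have h2 : P n = η • (ψ n).smulRight (e n) := by simp [P]
      rw [h2, ← hs] at h1
      simp only [smul_apply, ContinuousLinearMap.smulRight_apply, map_smul, map_add,
        (hψ n hn).1, ha n hn, hb n hn] at h1
      simp only [zero_add, Nat.Ico_succ_singleton, Finset.prod_singleton]
      rw [h1]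
      module
    | succ j ih =>
      intro hj
      have h0 := ih (by omega)
      have h1 := hw (n + (j + 1))
      have h2 : P (n + (j + 1)) = η • (φ (n + (j + 1))).smulRight (e (n + (j + 1))) := by
        have h3 : n < n + (j + 1) ∧ n + (j + 1) < n + (ℓ + 1) := by omega
        simp [P, h3]
      rw [h2, h0] at h1
      simp only [smul_apply, ContinuousLinearMap.smulRight_apply, map_smul, map_add,
        (hφ (n + (j + 1)) (by omega)).1, (hφ (n + (j + 1)) (by omega)).2.1,
        ha (n + (j + 1)) (by omega), hb (n + (j + 1)) (by omega)] at h1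
      have h4 : ∀ c : ℕ → ℝ, ∏ i ∈ Finset.Ico n (n + (j + 1 + 1)), c i =
          (∏ i ∈ Finset.Ico n (n + (j + 1)), c i) * c (n + (j + 1)) := fun c =>
        Finset.prod_Ico_succ_top (show n ≤ n + (j + 1) by omega) c
      rw [h4, h4]
      refine h1.trans ?_
      rw [pow_succ]
      change _ = _ • f (n + (j + 1) + 1) + _ • e (n + (j + 1) + 1)
      module
  have h1 := key ℓ le_rfl
  rw [← hα, ← hβ, ← hτ] at h1
  rw [hw (n + (ℓ + 1)), map_mem_eventualKer]
  have h2 : P (n + (ℓ + 1)) =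
      (-(α / τ)) • (φ (n + (ℓ + 1))).smulRight (f (n + (ℓ + 1))) := by
    simp [P]
  have h3 : w (n + (ℓ + 1)) + P (n + (ℓ + 1)) (w (n + (ℓ + 1))) =
      (s * τ) • e (n + (ℓ + 1)) := by
    rw [h2, h1]
    simp only [smul_apply, ContinuousLinearMap.smulRight_apply, map_smul, map_add,
      (hφ (n + (ℓ + 1)) (by omega)).1, (hφ (n + (ℓ + 1)) (by omega)).2.1]
    have h4 : s * α = α / τ * (s * τ) := by field_simp
    rw [h4]
    module
  rw [h3, (hN _ (by omega)).2.2.2.1]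
  exact Submodule.smul_mem _ _ (Submodule.mem_span_singleton_self _)

end LinearCocycle

/-! ### Perturbations of the identity with small support -/

section Bump

/-- A perturbation of the identity of a normed space with prescribed derivative `1 + L` at a
point `y₀`, supported in an arbitrarily small ball. Its `C¹` distance to the identity is controlled
by `‖L‖` alone, since the rescaling `y ↦ r θ ((y - y₀) / r)` does not change the size of the
derivative of `θ`. -/
theorem exists_contDiff_bump (E : Type*) [NormedAddCommGroup E] [InnerProductSpace ℝ E]
    [FiniteDimensional ℝ E] :
    ∃ C : ℝ, 0 < C ∧ ∀ (y₀ : E) (r : ℝ), 0 < r → ∀ L : E →L[ℝ] E, ∃ ψ : E → E,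
      ContDiff ℝ ∞ ψ ∧ ψ y₀ = y₀ ∧ fderiv ℝ ψ y₀ = ContinuousLinearMap.id ℝ E + L ∧
      (∀ y, y ∉ Metric.closedBall y₀ r → ψ y = y) ∧ (∀ y, ‖ψ y - y‖ ≤ r * (C * ‖L‖)) ∧
      ∀ y, ‖fderiv ℝ ψ y - ContinuousLinearMap.id ℝ E‖ ≤ C * ‖L‖ := by
  let χ : ContDiffBump (0 : E) := ⟨1 / 2, 1, by norm_num, by norm_num⟩
  let θ : E → E := fun y => χ y • y
  have hθ : ContDiff ℝ ∞ θ := χ.contDiff.smul contDiff_id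
  have hsupp : HasCompactSupport θ := χ.hasCompactSupport.smul_right
  obtain ⟨C₁, hC₁⟩ := hsupp.exists_bound_of_continuous hθ.continuous
  obtain ⟨C₂, hC₂⟩ := (hsupp.fderiv (𝕜 := ℝ)).exists_bound_of_continuous
    (hθ.continuous_fderiv (by simp))
  have hC₁0 : 0 ≤ C₁ := (norm_nonneg _).trans (hC₁ 0)
  have hC₂0 : 0 ≤ C₂ := (norm_nonneg _).trans (hC₂ 0)
  refine ⟨C₁ + C₂ + 1, by positivity, fun y₀ r hr L => ?_⟩
  have hderiv : ∀ y, HasFDerivAt (fun y => y + r • L (θ (r⁻¹ • (y - y₀))))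
      (ContinuousLinearMap.id ℝ E + L.comp (fderiv ℝ θ (r⁻¹ • (y - y₀)))) y := by
    intro y
    have h1 : HasFDerivAt (fun y => r⁻¹ • (y - y₀)) (r⁻¹ • ContinuousLinearMap.id ℝ E) y :=
      ((hasFDerivAt_id y).sub_const y₀).const_smul r⁻¹
    have h2 : HasFDerivAt θ (fderiv ℝ θ (r⁻¹ • (y - y₀))) (r⁻¹ • (y - y₀)) :=
      ((hθ.differentiable (by simp)) _).hasFDerivAt
    have h3 := (hasFDerivAt_id y).add ((L.hasFDerivAt.comp y (h2.comp y h1)).const_smul r)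
    refine h3.congr_fderiv ?_
    ext v
    simp [smul_smul, hr.ne']
  refine ⟨fun y => y + r • L (θ (r⁻¹ • (y - y₀))), ?_, ?_, ?_, ?_, ?_, ?_⟩
  · exact contDiff_id.add (contDiff_const.smul (L.contDiff.comp (hθ.comp
      (contDiff_const.smul (contDiff_id.sub contDiff_const)))))
  · simp [θ]
  · rw [(hderiv y₀).fderiv, sub_self, smul_zero]
    have h1 : θ =ᶠ[𝓝 0] id := by
      filter_upwards [χ.eventuallyEq_one] with y hy
      simp [θ, hy]
    rw [h1.fderiv_eq, fderiv_id, ContinuousLinearMap.comp_id]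
  · intro y hy
    have h1 : χ (r⁻¹ • (y - y₀)) = 0 := by
      refine χ.zero_of_le_dist ?_
      rw [dist_zero_right, norm_smul, norm_inv, Real.norm_of_nonneg hr.le]
      rw [Metric.mem_closedBall, not_le, dist_eq_norm] at hy
      change 1 ≤ _
      rw [inv_mul_eq_div, le_div_iff₀ hr]
      linarith
    simp [θ, h1]
  · intro y
    rw [add_sub_cancel_left, norm_smul, Real.norm_of_nonneg hr.le]
    have h1 := (L.le_opNorm (θ (r⁻¹ • (y - y₀)))).trans
      (mul_le_mul_of_nonneg_left (hC₁ _) (norm_nonneg _))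
    gcongr
    nlinarith [norm_nonneg L]
  · intro y
    rw [(hderiv y).fderiv, add_sub_cancel_left]
    have h1 := (L.opNorm_comp_le (fderiv ℝ θ (r⁻¹ • (y - y₀)))).trans
      (mul_le_mul_of_nonneg_left (hC₂ _) (norm_nonneg _))
    nlinarith [norm_nonneg L]

variable {M : Type*} [TopologicalSpace M] [ChartedSpace (EuclideanSpace ℝ (Fin 2)) M]

theorem tangentMap_congr {h₁ h₂ : M → M} {p : TangentBundle (𝓡 2) M}
    (h : h₁ =ᶠ[𝓝 p.proj] h₂) : tangentMap (𝓡 2) (𝓡 2) h₁ p = tangentMap (𝓡 2) (𝓡 2) h₂ p := by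
  unfold tangentMap
  rw [Bundle.TotalSpace.mk.injEq]
  exact ⟨h.eq_of_nhds, heq_of_eq (by rw [h.mfderiv_eq]; rfl)⟩

/-- Perturbations of the identity with disjoint supports can be carried out simultaneously. -/
theorem exists_glue {ι : Type*} [Finite ι] {N : ι → Set M} (hN : ∀ i, IsOpen (N i))
    (hdisj : Pairwise (Function.onFun Disjoint N)) (h : ι → End1 M)
    (hid : ∀ i, ∀ x, x ∉ N i → h i =ᶠ[𝓝 x] id) :
    ∃ g : End1 M, (∀ i, ∀ x ∈ N i, g =ᶠ[𝓝 x] h i) ∧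
      ∀ x, (∀ i, x ∉ N i) → g =ᶠ[𝓝 x] id := by
  classical
  let g : M → M := fun x => if hx : ∃ i, x ∈ N i then h hx.choose x else x
  have hgi : ∀ i, ∀ x ∈ N i, g x = h i x := by
    intro i x hx
    have hex : ∃ i, x ∈ N i := ⟨i, hx⟩
    have : hex.choose = i := by
      by_contra hne
      exact Set.disjoint_left.1 (hdisj hne) hex.choose_spec hx
    simp only [g, dif_pos hex, this]
  have h1 : ∀ i, ∀ x ∈ N i, g =ᶠ[𝓝 x] h i := fun i x hx =>
    Filter.eventually_of_mem ((hN i).mem_nhds hx) (hgi i)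
  have h2 : ∀ x, (∀ i, x ∉ N i) → g =ᶠ[𝓝 x] id := by
    intro x hx
    filter_upwards [Filter.eventually_all.2 fun i => hid i x (hx i)] with y hy
    by_cases hex : ∃ i, y ∈ N i
    · obtain ⟨i, hi⟩ := hex
      rw [hgi i y hi, hy i]
    · simp only [g, dif_neg hex, id]
  refine ⟨⟨g, fun x => ?_⟩, h1, h2⟩
  by_cases hex : ∃ i, x ∈ N i
  · obtain ⟨i, hi⟩ := hex
    exact (h i).contMDiff.contMDiffAt.congr_of_eventuallyEq (h1 i x hi)
  · exact contMDiffAt_id.congr_of_eventuallyEq (h2 x (by simpa using hex))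

variable [IsManifold (𝓡 2) ∞ M]

/-- The vector obtained from `p ∈ TM` by adding `w` to the base point and applying `1 + Q` to the
vector part, both read in the chart at `c`. -/
def chartShift (c : M) (w : EuclideanSpace ℝ (Fin 2))
    (Q : EuclideanSpace ℝ (Fin 2) →L[ℝ] EuclideanSpace ℝ (Fin 2)) (p : TangentBundle (𝓡 2) M) :
    TangentBundle (𝓡 2) M :=
  let e := trivializationAt (EuclideanSpace ℝ (Fin 2)) (TangentSpace (𝓡 2) : M → Type _) c
  e.toOpenPartialHomeomorph.symm
    ((extChartAt (𝓡 2) c).symm (extChartAt (𝓡 2) c p.proj + w), (e p).2 + Q (e p).2)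

theorem continuousAt_chartShift (c : M) {p : TangentBundle (𝓡 2) M}
    (hp : p.proj ∈ (extChartAt (𝓡 2) c).source) :
    ContinuousAt (fun q : (EuclideanSpace ℝ (Fin 2) × (EuclideanSpace ℝ (Fin 2) →L[ℝ]
      EuclideanSpace ℝ (Fin 2))) × TangentBundle (𝓡 2) M => chartShift c q.1.1 q.1.2 q.2)
      ((0, 0), p) ∧ chartShift c 0 0 p = p := by
  set e := trivializationAt (EuclideanSpace ℝ (Fin 2)) (TangentSpace (𝓡 2) : M → Type _) c with he
  have hps : p ∈ e.source := by
    rw [e.mem_source]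
    simpa [he] using hp
  have hval : ((extChartAt (𝓡 2) c).symm (extChartAt (𝓡 2) c p.proj + 0),
      (e p).2 + (0 : EuclideanSpace ℝ (Fin 2) →L[ℝ] EuclideanSpace ℝ (Fin 2)) (e p).2) = e p := by
    rw [add_zero, (extChartAt (𝓡 2) c).left_inv hp, zero_apply, add_zero]
    exact Prod.ext (e.coe_fst hps).symm rfl
  refine ⟨?_, ?_⟩
  · have he2 : ContinuousAt (fun q : (EuclideanSpace ℝ (Fin 2) × (EuclideanSpace ℝ (Fin 2) →L[ℝ]
        EuclideanSpace ℝ (Fin 2))) × TangentBundle (𝓡 2) M => (e q.2).2) ((0, 0), p) :=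
      continuousAt_snd.comp (ContinuousAt.comp (f := Prod.snd)
        (e.toOpenPartialHomeomorph.continuousAt hps) continuousAt_snd)
    have hproj : ContinuousAt (fun q : (EuclideanSpace ℝ (Fin 2) × (EuclideanSpace ℝ (Fin 2) →L[ℝ]
        EuclideanSpace ℝ (Fin 2))) × TangentBundle (𝓡 2) M =>
          extChartAt (𝓡 2) c q.2.proj + q.1.1) ((0, 0), p) := by
      refine ContinuousAt.add ?_ (continuousAt_fst.comp continuousAt_fst)
      refine ContinuousAt.comp (f := fun q : (EuclideanSpace ℝ (Fin 2) ×
        (EuclideanSpace ℝ (Fin 2) →L[ℝ] EuclideanSpace ℝ (Fin 2))) × TangentBundle (𝓡 2) M =>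
          q.2.proj) (continuousAt_extChartAt' hp) ?_
      exact (FiberBundle.continuous_proj _ _).continuousAt.comp continuousAt_snd
    refine ContinuousAt.comp (g := e.toOpenPartialHomeomorph.symm) ?_
      (ContinuousAt.prodMk (ContinuousAt.comp (g := (extChartAt (𝓡 2) c).symm) ?_ hproj)
        (he2.add ((continuousAt_snd.comp continuousAt_fst).clm_apply he2)))
    · refine e.toOpenPartialHomeomorph.symm.continuousAt ?_
      rw [hval]
      exact e.toOpenPartialHomeomorph.map_source hps
    · simp only [add_zero]
      exact continuousAt_extChartAt_symm' hp
  · unfold chartShift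
    rw [← he]
    simp only [hval]
    exact e.toOpenPartialHomeomorph.left_inv hps

/-- A perturbation of the identity of `M`, with arbitrarily small support around `z`, and with the
prescribed derivative `1 + L` in the chart at `c`. Its effect on tangent vectors is controlled by
`‖L‖`. -/
theorem exists_chart_bump [T2Space M] :
    ∃ C : ℝ, 0 < C ∧ ∀ (c z : M), z ∈ (extChartAt (𝓡 2) c).source → ∀ N ∈ 𝓝 z,
      ∀ L : EuclideanSpace ℝ (Fin 2) →L[ℝ] EuclideanSpace ℝ (Fin 2), C * ‖L‖ ≤ 1 →
      ∃ h : End1 M, (∀ x, x ∉ N → h =ᶠ[𝓝 x] id) ∧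
        (∀ v : TangentSpace (𝓡 2) z, tangentMap (𝓡 2) (𝓡 2) h ⟨z, v⟩ = chartShift c 0 L ⟨z, v⟩) ∧
        ∀ p : TangentBundle (𝓡 2) M, p.proj ∈ N → tangentMap (𝓡 2) (𝓡 2) h p = p ∨
          ∃ w Q, ‖w‖ ≤ C * ‖L‖ ∧ ‖Q‖ ≤ C * ‖L‖ ∧
            tangentMap (𝓡 2) (𝓡 2) h p = chartShift c w Q p := by
  classical
  obtain ⟨C, hC, hbump⟩ := exists_contDiff_bump (EuclideanSpace ℝ (Fin 2))
  refine ⟨C, hC, fun c z hz N hN L hL => ?_⟩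
  set φ := extChartAt (𝓡 2) c with hφ
  have hsrc : IsOpen φ.source := isOpen_extChartAt_source c
  have htgt : IsOpen φ.target := isOpen_extChartAt_target c
  obtain ⟨R, hR, hRsub⟩ : ∃ R > 0, Metric.closedBall (φ z) R ⊆ φ.target ∩ φ.symm ⁻¹' N := by
    refine Metric.nhds_basis_closedBall.mem_iff.1 (Filter.inter_mem
      (htgt.mem_nhds (φ.map_source hz)) ((continuousAt_extChartAt_symm' hz).preimage_mem_nhds ?_))
    rwa [← hφ, φ.left_inv hz]
  set r := min 1 (R / 2) with hr
  have hr0 : 0 < r := by positivity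
  have hr1 : r ≤ 1 := min_le_left _ _
  have hrR : r + r ≤ R := by linarith [min_le_right 1 (R / 2)]
  obtain ⟨ψ, hψ, hψ0, hψd, hψid, hψ1, hψ2⟩ := hbump (φ z) r hr0 L
  have hψt : ∀ y ∈ φ.target, ψ y ∈ φ.target := by
    intro y hy
    by_cases hyr : y ∈ Metric.closedBall (φ z) r
    · refine (hRsub ?_).1
      rw [Metric.mem_closedBall] at hyr ⊢
      have h1 : dist (ψ y) y ≤ r * 1 := by
        rw [dist_eq_norm]
        exact (hψ1 y).trans (mul_le_mul_of_nonneg_left hL hr0.le)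
      linarith [dist_triangle (ψ y) y (φ z)]
    · rwa [hψid y hyr]
  let h : M → M := fun x => if x ∈ φ.source then φ.symm (ψ (φ x)) else x
  set K : Set M := φ.symm '' Metric.closedBall (φ z) r with hK
  have hball : Metric.closedBall (φ z) r ⊆ φ.target ∩ φ.symm ⁻¹' N :=
    (Metric.closedBall_subset_closedBall (by linarith)).trans hRsub
  have hKc : IsClosed K := ((isCompact_closedBall _ _).image_of_continuousOn
    ((continuousOn_extChartAt_symm c).mono fun y hy => (hball hy).1)).isClosed
  have hKsrc : K ⊆ φ.source := by
    rintro _ ⟨y, hy, rfl⟩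
    exact φ.map_target (hball hy).1
  have hKN : K ⊆ N := by
    rintro _ ⟨y, hy, rfl⟩
    exact (hball hy).2
  have hhK : ∀ x, x ∉ K → h =ᶠ[𝓝 x] id := by
    intro x hx
    filter_upwards [hKc.isOpen_compl.mem_nhds hx] with y hy
    by_cases hys : y ∈ φ.source
    · have : φ y ∉ Metric.closedBall (φ z) r := fun h' => hy ⟨φ y, h', φ.left_inv hys⟩
      simp only [h, if_pos hys, hψid _ this, φ.left_inv hys, id]
    · simp only [h, if_neg hys, id]
  have hhs : ∀ x ∈ φ.source, h =ᶠ[𝓝 x] φ.symm ∘ ψ ∘ φ := by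
    intro x hx
    filter_upwards [hsrc.mem_nhds hx] with y hy
    simp only [h, if_pos hy, Function.comp]
  have hsm : ContMDiff (𝓡 2) (𝓡 2) 1 h := by
    intro x
    by_cases hx : x ∈ K
    · refine ContMDiffAt.congr_of_eventuallyEq ?_ (hhs x (hKsrc hx))
      have h1 : ContMDiffAt (𝓡 2) 𝓘(ℝ, EuclideanSpace ℝ (Fin 2)) 1 φ x :=
        contMDiffAt_extChartAt' (by rw [← extChartAt_source (𝓡 2)]; exact hKsrc hx)
      have h2 : ContMDiffAt 𝓘(ℝ, EuclideanSpace ℝ (Fin 2)) 𝓘(ℝ, EuclideanSpace ℝ (Fin 2)) 1 ψ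
          (φ x) := (hψ.of_le (by simp)).contMDiff.contMDiffAt
      have h3 : ContMDiffAt 𝓘(ℝ, EuclideanSpace ℝ (Fin 2)) (𝓡 2) 1 φ.symm (ψ (φ x)) :=
        (contMDiffOn_extChartAt_symm c).contMDiffAt
          (htgt.mem_nhds (hψt _ (φ.map_source (hKsrc hx))))
      exact ContMDiffAt.comp x h3 (h2.comp x h1)
    · exact contMDiffAt_id.congr_of_eventuallyEq (hhK x hx)
  have key : ∀ p : TangentBundle (𝓡 2) M, p.proj ∈ φ.source → tangentMap (𝓡 2) (𝓡 2) h p =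
      chartShift c (ψ (φ p.proj) - φ p.proj)
        (fderiv ℝ ψ (φ p.proj) - ContinuousLinearMap.id ℝ (EuclideanSpace ℝ (Fin 2))) p := by
    rintro ⟨x, v⟩ hx
    change x ∈ φ.source at hx
    set e := trivializationAt (EuclideanSpace ℝ (Fin 2)) (TangentSpace (𝓡 2) : M → Type _) c
      with he
    have hes : ∀ q : TangentBundle (𝓡 2) M, q.proj ∈ φ.source → q ∈ e.source := fun q hq => by
      rw [e.mem_source]
      simpa [he, hφ] using hq
    have heq : ∀ q : TangentBundle (𝓡 2) M, q.proj ∈ φ.source →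
        e q = (q.proj, mfderiv (𝓡 2) 𝓘(ℝ, EuclideanSpace ℝ (Fin 2)) φ q.proj q.2) := by
      rintro ⟨y, u⟩ hy
      have hy' : y ∈ (chartAt (EuclideanSpace ℝ (Fin 2)) c).source := by
        simpa [hφ] using hy
      refine Prod.ext (e.coe_fst (hes _ hy)) ?_
      have h0 : (e ⟨y, u⟩).2 = e.continuousLinearMapAt ℝ y u := by
        rw [Bundle.Trivialization.continuousLinearMapAt_apply,
          Bundle.Trivialization.linearMapAt_apply, if_pos (by simpa [he] using hy')]
      exact h0.trans (DFunLike.congr_fun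
        (TangentBundle.continuousLinearMapAt_trivializationAt hy') u)
    have hhx : h x = φ.symm (ψ (φ x)) := if_pos hx
    have hhxs : h x ∈ φ.source := by
      rw [hhx]; exact φ.map_target (hψt _ (φ.map_source hx))
    have hcomp : φ ∘ h =ᶠ[𝓝 x] ψ ∘ φ := by
      filter_upwards [hsrc.mem_nhds hx] with y hy
      simp only [h, if_pos hy, Function.comp]
      exact φ.right_inv (hψt _ (φ.map_source hy))
    have hφd : ∀ y ∈ φ.source, MDifferentiableAt (𝓡 2) 𝓘(ℝ, EuclideanSpace ℝ (Fin 2)) φ y :=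
      fun y hy => mdifferentiableAt_extChartAt (by rw [← extChartAt_source (𝓡 2)]; exact hy)
    have hψd' : DifferentiableAt ℝ ψ (φ x) := hψ.differentiable (by simp) _
    have hchain : (mfderiv (𝓡 2) 𝓘(ℝ, EuclideanSpace ℝ (Fin 2)) φ (h x)).comp
        (mfderiv (𝓡 2) (𝓡 2) h x) =
        (fderiv ℝ ψ (φ x)).comp (mfderiv (𝓡 2) 𝓘(ℝ, EuclideanSpace ℝ (Fin 2)) φ x) := by
      rw [← mfderiv_comp x (hφd _ hhxs) (hsm.mdifferentiable (by simp) x), hcomp.mfderiv_eq,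
        mfderiv_comp x hψd'.mdifferentiableAt (hφd _ hx), mfderiv_eq_fderiv]
      rfl
    have h1 : e (tangentMap (𝓡 2) (𝓡 2) h ⟨x, v⟩) = (φ.symm (φ x + (ψ (φ x) - φ x)),
        (e ⟨x, v⟩).2 +
          (fderiv ℝ ψ (φ x) - ContinuousLinearMap.id ℝ (EuclideanSpace ℝ (Fin 2))) (e ⟨x, v⟩).2) := by
      rw [heq _ hhxs, heq ⟨x, v⟩ hx]
      refine Prod.ext ?_ ?_
      · simp only [tangentMap, add_sub_cancel]
        exact hhx
      · have h2 := DFunLike.congr_fun hchain v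
        exact h2.trans (add_sub_cancel _ _).symm
    exact (e.toOpenPartialHomeomorph.left_inv (hes _ hhxs)).symm.trans
      (congrArg e.toOpenPartialHomeomorph.symm h1)
  refine ⟨⟨h, hsm⟩, fun x hx => hhK x fun hx' => hx (hKN hx'), fun v => ?_, fun p _ => ?_⟩
  · have h1 := key ⟨z, v⟩ hz
    simp only [hψ0, hψd, sub_self, add_sub_cancel_left] at h1
    exact h1
  · by_cases hp : p.proj ∈ φ.source
    · refine Or.inr ⟨_, _, ?_, hψ2 _, key p hp⟩
      refine (hψ1 _).trans ?_
      exact mul_le_of_le_one_left (by positivity) hr1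
    · left
      have h1 := tangentMap_congr (hhK p.proj fun h' => hp (hKsrc h'))
      rw [tangentMap_id] at h1
      exact h1

end Bump

/-! ### The perturbation lemma -/

section Perturbation

variable {M : Type*} [TopologicalSpace M] [ChartedSpace (EuclideanSpace ℝ (Fin 2)) M]
  [IsManifold (𝓡 2) ∞ M]

/-- A neighbourhood of the identity in `C(TM, TM)` contains all maps satisfying a pointwise
condition, given by a relation `V` on `TM`, which holds for small chart shifts, locally
uniformly in the base point. A pointwise condition can be checked on each of finitely many
perturbations with disjoint supports separately. -/
theorem exists_rel_of_mem_nhds_id [CompactSpace M] [T2Space M]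
    {W : Set C(TangentBundle (𝓡 2) M, TangentBundle (𝓡 2) M)}
    (hW : W ∈ 𝓝 (ContinuousMap.id (TangentBundle (𝓡 2) M))) :
    ∃ V : Set (TangentBundle (𝓡 2) M × TangentBundle (𝓡 2) M), (∀ p, (p, p) ∈ V) ∧
      (∀ H : C(TangentBundle (𝓡 2) M, TangentBundle (𝓡 2) M), (∀ p, (p, H p) ∈ V) → H ∈ W) ∧
      ∀ c : M, ∃ N ∈ 𝓝 c, ∃ ε > 0, ∀ p : TangentBundle (𝓡 2) M, p.proj ∈ N →
        ∀ w Q, ‖w‖ ≤ ε → ‖Q‖ ≤ ε → (p, chartShift c w Q p) ∈ V := by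
  obtain ⟨S, hSfin, hS, hSW⟩ := ContinuousMap.mem_nhds_iff.1 hW
  refine ⟨{pq | ∀ KU ∈ S, pq.1 ∈ KU.1 → pq.2 ∈ KU.2}, fun p KU hKU hp => (hS _ _ hKU).2.2 hp,
    fun H hH => hSW fun K U hKU p hp => hH p (K, U) hKU hp, fun c => ?_⟩
  obtain ⟨N, hN, hNc, hNs⟩ := exists_mem_nhds_isClosed_subset (extChartAt_source_mem_nhds
    (I := 𝓡 2) c)
  have hev : ∀ᶠ a : EuclideanSpace ℝ (Fin 2) × (EuclideanSpace ℝ (Fin 2) →L[ℝ]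
      EuclideanSpace ℝ (Fin 2)) in 𝓝 (0, 0), ∀ KU ∈ S, ∀ p ∈ KU.1 ∩ Bundle.TotalSpace.proj ⁻¹' N,
        chartShift c a.1 a.2 p ∈ KU.2 := by
    rw [Filter.eventually_all_finite hSfin]
    rintro ⟨K, U⟩ hKU
    obtain ⟨hK, hU, hKU'⟩ := hS K U hKU
    refine (hK.inter_right (hNc.preimage (FiberBundle.continuous_proj _
      _))).eventually_forall_of_forall_eventually fun p hp => ?_
    obtain ⟨h1, h2⟩ := continuousAt_chartShift c (hNs hp.2)
    exact h1.eventually_mem (hU.mem_nhds (by simpa [h2] using hKU' hp.1))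
  obtain ⟨ε, hε, hball⟩ := Metric.nhds_basis_closedBall.eventually_iff.1 hev
  refine ⟨N, hN, ε, hε, fun p hp w Q hw hQ KU hKU hpK => ?_⟩
  refine hball (x := (w, Q)) ?_ KU hKU p ⟨hpK, hp⟩
  rw [Metric.mem_closedBall, dist_eq_norm, ← Prod.zero_eq_mk, sub_zero]
  exact max_le hw hQ

variable [CompactSpace M] [T2Space M]
    [Bundle.RiemannianBundle (fun x : M => TangentSpace (𝓡 2) x)]
    [IsContinuousRiemannianBundle (EuclideanSpace ℝ (Fin 2))
      (fun x : M => TangentSpace (𝓡 2) x)]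

/-- The perturbation lemma: arbitrarily close to the identity there are maps which fix the points
of a given finite set, with prescribed derivatives there, as soon as these derivatives are close to
the identity; how close depends neither on the points nor on their number. -/
theorem exists_perturbation_id
    {W : Set C(TangentBundle (𝓡 2) M, TangentBundle (𝓡 2) M)}
    (hW : W ∈ 𝓝 (ContinuousMap.id (TangentBundle (𝓡 2) M))) :
    ∃ δ > 0, ∀ {ι : Type} [Finite ι] (z : ι → M), Function.Injective z →
      ∀ P : ∀ i, TangentSpace (𝓡 2) (z i) →L[ℝ] TangentSpace (𝓡 2) (z i), (∀ i, ‖P i‖ ≤ δ) →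
      ∃ h : End1 M, tangentMapC h ∈ W ∧ ∀ (i : ι) (v : TangentSpace (𝓡 2) (z i)),
        tangentMap (𝓡 2) (𝓡 2) h ⟨z i, v⟩ = ⟨z i, v + P i v⟩ := by
  obtain ⟨V, hVrefl, hVW, hV⟩ := exists_rel_of_mem_nhds_id hW
  obtain ⟨C, hC, hbump⟩ := exists_chart_bump (M := M)
  have hloc : ∃ δ > 0, ∀ z ∈ (univ : Set M), ∀ N ∈ 𝓝 z,
      ∀ P : TangentSpace (𝓡 2) z →L[ℝ] TangentSpace (𝓡 2) z, ‖P‖ ≤ δ →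
      ∃ h : End1 M, (∀ x, x ∉ N → h =ᶠ[𝓝 x] id) ∧
        (∀ v : TangentSpace (𝓡 2) z, tangentMap (𝓡 2) (𝓡 2) h ⟨z, v⟩ = ⟨z, v + P v⟩) ∧
        ∀ p : TangentBundle (𝓡 2) M, (p, tangentMap (𝓡 2) (𝓡 2) h p) ∈ V := by
    refine isCompact_univ.induction_on ⟨1, one_pos, by simp⟩ ?_ ?_ ?_
    · rintro s t hst ⟨δ, hδ, h⟩
      exact ⟨δ, hδ, fun z hz => h z (hst hz)⟩
    · rintro s t ⟨δ, hδ, h⟩ ⟨δ', hδ', h'⟩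
      refine ⟨min δ δ', lt_min hδ hδ', fun z hz N hN P hP => hz.elim (fun hz => ?_) fun hz => ?_⟩
      · exact h z hz N hN P (hP.trans (min_le_left _ _))
      · exact h' z hz N hN P (hP.trans (min_le_right _ _))
    · intro c _
      obtain ⟨O, hO, ε, hε, hOV⟩ := hV c
      obtain ⟨C₁, hC₁, h₁⟩ := eventually_norm_trivializationAt_lt (EuclideanSpace ℝ (Fin 2))
        (fun x : M => TangentSpace (𝓡 2) x) c
      obtain ⟨C₂, hC₂, h₂⟩ := eventually_norm_symmL_trivializationAt_lt (EuclideanSpace ℝ (Fin 2))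
        (fun x : M => TangentSpace (𝓡 2) x) c
      have hev := h₁.and (h₂.and ((eventually_mem_nhds_iff.2 hO).and
        (extChartAt_source_mem_nhds (I := 𝓡 2) c)))
      refine ⟨_, mem_nhdsWithin_of_mem_nhds hev, min 1 ε / (C * (C₁ * C₂)), by positivity, ?_⟩
      rintro z ⟨hz₁, hz₂, hzO, hzs⟩ N hN P hP
      replace hzs : z ∈ (extChartAt (𝓡 2) c).source := hzs
      set e := trivializationAt (EuclideanSpace ℝ (Fin 2)) (fun x : M => TangentSpace (𝓡 2) x) c
        with he
      have hze : z ∈ e.baseSet := by simpa [he] using hzs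
      -- the perturbation `P` read in the trivialization at `c`
      let L : EuclideanSpace ℝ (Fin 2) →L[ℝ] EuclideanSpace ℝ (Fin 2) :=
        (e.continuousLinearMapAt ℝ z).comp (P.comp (e.symmL ℝ z))
      have hL : C * ‖L‖ ≤ min 1 ε := by
        have h3 : ‖L‖ ≤ C₁ * (‖P‖ * C₂) := by
          refine (ContinuousLinearMap.opNorm_comp_le _ _).trans ?_
          refine mul_le_mul hz₁.le ?_ (norm_nonneg _) hC₁.le
          refine (ContinuousLinearMap.opNorm_comp_le _ _).trans ?_
          exact mul_le_mul_of_nonneg_left hz₂.le (norm_nonneg _)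
        rw [le_div_iff₀ (by positivity)] at hP
        nlinarith
      obtain ⟨h, hh1, hh2, hh3⟩ := hbump c z hzs (N ∩ O) (Filter.inter_mem hN hzO) L
        (hL.trans (min_le_left _ _))
      refine ⟨h, fun x hx => hh1 x fun hx' => hx hx'.1, fun v => ?_, fun p => ?_⟩
      · rw [hh2 v]
        have hsrc : ∀ u : TangentSpace (𝓡 2) z, (⟨z, u⟩ : TangentBundle (𝓡 2) M) ∈ e.source :=
          fun u => e.mem_source.2 hze
        have hsnd : ∀ u : TangentSpace (𝓡 2) z,
            e ⟨z, u⟩ = (z, e.continuousLinearMapAt ℝ z u) := fun u => by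
          refine Prod.ext (e.coe_fst (hsrc u)) ?_
          rw [Bundle.Trivialization.continuousLinearMapAt_apply,
            Bundle.Trivialization.linearMapAt_apply, if_pos hze]
        refine Eq.trans ?_ (e.toOpenPartialHomeomorph.left_inv (hsrc (v + P v)))
        refine congrArg e.toOpenPartialHomeomorph.symm (Eq.trans ?_ (hsnd (v + P v)).symm)
        refine Prod.ext ?_ ?_
        · simp only [add_zero]
          exact (extChartAt (𝓡 2) c).left_inv hzs
        · change (e ⟨z, v⟩).2 + L (e ⟨z, v⟩).2 = _
          rw [hsnd v, map_add]
          simp only [L, ContinuousLinearMap.comp_apply]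
          rw [Bundle.Trivialization.symmL_continuousLinearMapAt _ hze]
      · by_cases hp : p.proj ∈ N ∩ O
        · rcases hh3 p hp with h4 | ⟨w, Q, hw, hQ, h4⟩
          · rw [h4]; exact hVrefl p
          · rw [h4]
            exact hOV p hp.2 w Q (hw.trans (hL.trans (min_le_right _ _)))
              (hQ.trans (hL.trans (min_le_right _ _)))
        · have h4 := tangentMap_congr (hh1 p.proj hp)
          rw [tangentMap_id] at h4
          rw [h4]
          exact hVrefl p
  obtain ⟨δ, hδ, hloc⟩ := hloc
  refine ⟨δ, hδ, fun {ι} _ z hz P hP => ?_⟩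
  obtain ⟨N, hN, hdisj⟩ := (Set.finite_range z).t2_separation
  choose h hh1 hh2 hh3 using fun i => hloc (z i) trivial (N (z i))
    ((hN (z i)).2.mem_nhds (hN (z i)).1) (P i) (hP i)
  obtain ⟨g, hg1, hg2⟩ := exists_glue (N := fun i => N (z i)) (fun i => (hN (z i)).2)
    (fun i j hij => hdisj (mem_range_self i) (mem_range_self j) (hz.ne hij)) h hh1
  refine ⟨g, hVW _ fun p => ?_, fun i v => ?_⟩
  · change (p, tangentMap (𝓡 2) (𝓡 2) g p) ∈ V
    by_cases hp : ∃ i, p.proj ∈ N (z i)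
    · obtain ⟨i, hi⟩ := hp
      rw [tangentMap_congr (hg1 i p.proj hi)]
      exact hh3 i p
    · have h4 := tangentMap_congr (hg2 p.proj (by simpa using hp))
      rw [tangentMap_id] at h4
      rw [h4]
      exact hVrefl p
  · rw [← hh2 i v]
    exact tangentMap_congr (hg1 i (z i) (hN (z i)).1)

end Perturbation

/-! ### Derivatives along a dense forward orbit -/

section ForwardOrbit

variable {M : Type*} [TopologicalSpace M] [ChartedSpace (EuclideanSpace ℝ (Fin 2)) M]

theorem finrank_tangentSpace (x : M) : finrank ℝ (TangentSpace (𝓡 2) x) = 2 :=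
  finrank_euclideanSpace_fin (𝕜 := ℝ) (n := 2)

theorem neBot_nhdsNE (x : M) : (𝓝[≠] x).NeBot := by
  rw [Filter.neBot_iff]
  intro h
  have hx : ({x} : Set M) ∈ 𝓝 x := by
    rw [← mem_interior_iff_mem_nhds, (isOpen_singleton_iff_punctured_nhds x).2 h |>.interior_eq]
    rfl
  have h1 : (extChartAt (𝓡 2) x).symm ⁻¹' {x} ∩ (extChartAt (𝓡 2) x).target ∈
      𝓝 (extChartAt (𝓡 2) x x) :=
    Filter.inter_mem ((continuousAt_extChartAt_symm x).preimage_mem_nhds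
      (by rwa [extChartAt_to_inv])) (extChartAt_target_mem_nhds x)
  have h2 : ({extChartAt (𝓡 2) x x} : Set (EuclideanSpace ℝ (Fin 2))) ∈
      𝓝 (extChartAt (𝓡 2) x x) := by
    refine Filter.mem_of_superset h1 fun y hy => ?_
    have h3 : (extChartAt (𝓡 2) x).symm y = x := hy.1
    rw [mem_singleton_iff, ← (extChartAt (𝓡 2) x).right_inv hy.2, h3]
  have h4 : (𝓝[≠] (extChartAt (𝓡 2) x x)).NeBot := inferInstance
  rw [Filter.neBot_iff] at h4
  exact h4 (Filter.empty_mem_iff_bot.1 (mem_nhdsWithin_iff_exists_mem_nhds_inter.2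
    ⟨_, h2, by simp⟩))

/-- The forward orbit of `x`, written recursively so that the entry of index `n + 1` is literally
the image of the one of index `n`. -/
def forwardOrbit (f : End1 M) (x : M) : ℕ → M
  | 0 => x
  | n + 1 => f (forwardOrbit f x n)

theorem forwardOrbit_eq_iterate (f : End1 M) (x : M) (n : ℕ) : forwardOrbit f x n = f^[n] x := by
  induction n with
  | zero => rfl
  | succ n ih => rw [Function.iterate_succ_apply', ← ih]; rfl

theorem forwardOrbit_add (f : End1 M) (x : M) (n k : ℕ) :
    forwardOrbit f x (n + k) = f^[k] (forwardOrbit f x n) := by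
  rw [forwardOrbit_eq_iterate, forwardOrbit_eq_iterate, ← Function.iterate_add_apply, add_comm]

theorem exists_forwardOrbit_mem [T2Space M] {f : End1 M} {x : M}
    (hx : Dense (range (forwardOrbit f x))) {O : Set M} (hO : IsOpen O) (hne : O.Nonempty)
    (N : ℕ) : ∃ n, N ≤ n ∧ forwardOrbit f x n ∈ O := by
  have hp : ∀ y : M, (𝓝[≠] y).NeBot := neBot_nhdsNE
  have hfin : (forwardOrbit f x '' Iio N).Finite := (finite_Iio N).image _
  obtain ⟨_, hy, ⟨n, rfl⟩, hn⟩ := (hx.sdiff_finite hfin).inter_open_nonempty O hO hne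
  exact ⟨n, by by_contra! h; exact hn ⟨n, h, rfl⟩, hy⟩

theorem injective_forwardOrbit [T2Space M] {f : End1 M} {x : M}
    (hx : Dense (range (forwardOrbit f x))) : Function.Injective (forwardOrbit f x) := by
  have hp : ∀ y : M, (𝓝[≠] y).NeBot := neBot_nhdsNE
  by_contra hinj
  obtain ⟨i, j, hij, hlt⟩ : ∃ i j, forwardOrbit f x i = forwardOrbit f x j ∧ i < j := by
    simp only [Function.Injective, not_forall] at hinj
    obtain ⟨i, j, h, hne⟩ := hinj
    rcases lt_or_gt_of_ne hne with h' | h'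
    exacts [⟨i, j, h, h'⟩, ⟨j, i, h.symm, h'⟩]
  have hall : ∀ n, forwardOrbit f x n ∈ forwardOrbit f x '' Iio j := by
    intro n
    induction n with
    | zero => exact ⟨0, Nat.zero_lt_of_lt hlt, rfl⟩
    | succ n ih =>
      obtain ⟨k, hk, hkn⟩ := ih
      have h1 : forwardOrbit f x (k + 1) = forwardOrbit f x (n + 1) := congrArg f hkn
      rcases (show k + 1 ≤ j from hk).lt_or_eq with h | h
      · exact ⟨k + 1, h, h1⟩
      · exact ⟨i, hlt, by rw [hij, ← h, h1]⟩
  have hd := hx.sdiff_finite ((finite_Iio j).image (forwardOrbit f x))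
  rw [show range (forwardOrbit f x) \ forwardOrbit f x '' Iio j = ∅ from
    sdiff_eq_empty.2 (range_subset_iff.2 hall)] at hd
  have : Nonempty M := ⟨x⟩
  simpa using hd.nonempty

theorem isInvertible_of_injective {A : EuclideanSpace ℝ (Fin 2) →L[ℝ] EuclideanSpace ℝ (Fin 2)}
    (hA : ∀ v, A v = 0 → v = 0) : A.IsInvertible := by
  have hinj : Function.Injective A.toLinearMap := (injective_iff_map_eq_zero A.toLinearMap).2 hA
  exact ⟨(LinearEquiv.ofInjectiveEndo A.toLinearMap hinj).toContinuousLinearEquiv, by ext1 v; rfl⟩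

theorem exists_ne_zero_of_mem_criticalSet {f : End1 M} {x : M} (hx : x ∈ criticalSet f) :
    ∃ v : TangentSpace (𝓡 2) x, v ≠ 0 ∧ mfderiv (𝓡 2) (𝓡 2) f x v = 0 := by
  by_contra! h
  refine hx (isInvertible_of_injective (A := mfderiv (𝓡 2) (𝓡 2) f x) fun v hv => ?_)
  by_contra hv0
  exact h v hv0 hv

theorem mdifferentiable_iterate (f : End1 M) (n : ℕ) :
    MDifferentiable (𝓡 2) (𝓡 2) (f^[n] : M → M) := by
  induction n with
  | zero => exact mdifferentiable_id
  | succ n ih => exact ih.comp (f.contMDiff.mdifferentiable one_ne_zero)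

theorem kerDim_eq_two_of_forall {f : End1 M} {n : ℕ} {x : M} (h : ∀ v, derivIter f n x v = 0) :
    kerDim f n x = 2 := by
  have : LinearMap.ker (derivIter f n x).toLinearMap = ⊤ :=
    eq_top_iff.2 fun v _ => h v
  rw [kerDim, this, finrank_top, finrank_tangentSpace]

theorem tangentMap_iterate (f : End1 M) (n : ℕ) :
    tangentMap (𝓡 2) (𝓡 2) (f^[n] : M → M) = (tangentMap (𝓡 2) (𝓡 2) f)^[n] := by
  induction n with
  | zero => exact tangentMap_id
  | succ n ih =>
    rw [Function.iterate_succ, Function.iterate_succ, ← ih]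
    exact tangentMap_comp (mdifferentiable_iterate f n) (f.contMDiff.mdifferentiable one_ne_zero)

theorem derivIter_succ_apply (f : End1 M) (n : ℕ) (x : M) (v : TangentSpace (𝓡 2) x) :
    derivIter f (n + 1) x v = derivIter f n (f x) (mfderiv (𝓡 2) (𝓡 2) f x v) :=
  DFunLike.congr_fun (mfderiv_comp x (mdifferentiable_iterate f n (f x))
    (f.contMDiff.mdifferentiable one_ne_zero x)) v

/-- If `Df^n_x = 0`, then `f` has full-dimensional kernel, at the first critical point of the orbit
of `x`. -/
theorem hasFullDimensionalKernel_of_forall {f : End1 M} {n : ℕ} {x : M}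
    (h : ∀ v, derivIter f n x v = 0) : HasFullDimensionalKernel f := by
  induction n generalizing x with
  | zero =>
    have h1 : Nontrivial (TangentSpace (𝓡 2) x) :=
      nontrivial_of_finrank_pos (R := ℝ) (by rw [finrank_tangentSpace]; norm_num)
    obtain ⟨v, hv⟩ := exists_ne (0 : TangentSpace (𝓡 2) x)
    refine absurd ?_ hv
    have h2 := h v
    rw [derivIter, Function.iterate_zero, mfderiv_id] at h2
    exact h2
  | succ n ih =>
    by_cases hx : x ∈ criticalSet f
    · exact ⟨n + 1, by omega, x, hx, kerDim_eq_two_of_forall h⟩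
    · obtain ⟨e, he⟩ : (mfderiv (𝓡 2) (𝓡 2) f x).IsInvertible := not_not.1 hx
      refine ih (x := f x) fun u => ?_
      have h1 := h (e.symm u)
      rw [derivIter_succ_apply, ← he] at h1
      exact (congrArg (derivIter f n (f x)) (e.apply_symm_apply u)).symm.trans h1

variable [IsManifold (𝓡 2) ∞ M] [CompactSpace M] [T2Space M]
    [Bundle.RiemannianBundle (fun x : M => TangentSpace (𝓡 2) x)]
    [IsContinuousRiemannianBundle (EuclideanSpace ℝ (Fin 2))
      (fun x : M => TangentSpace (𝓡 2) x)]

/-- If `f` is not a limit of maps with full-dimensional kernel, then the products of derivatives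
along an infinite forward orbit do not vanish, even after a small perturbation: a perturbation of
the derivatives is realized by composing `f` with a map close to the identity. -/
theorem exists_stablyNonzero {f : End1 M}
    (hf : f ∉ closure {g : End1 M | HasFullDimensionalKernel g}) {x : M}
    (hinj : Function.Injective (forwardOrbit f x)) :
    ∃ δ > 0, StablyNonzero (T := fun n => TangentSpace (𝓡 2) (forwardOrbit f x n))
      (fun n => mfderiv (𝓡 2) (𝓡 2) f (forwardOrbit f x n)) δ := by
  rw [mem_closure_iff_nhds] at hf
  push Not at hf
  obtain ⟨t, ht, hempty⟩ := hf
  rw [nhds_induced, Filter.mem_comap] at ht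
  obtain ⟨W, hW, hWt⟩ := ht
  have hpost : ContinuousAt (fun H : C(TangentBundle (𝓡 2) M, TangentBundle (𝓡 2) M) =>
      (tangentMapC f).comp H) (ContinuousMap.id _) :=
    (ContinuousMap.continuous_postcomp (tangentMapC f)).continuousAt
  obtain ⟨δ, hδ, hpert⟩ := exists_perturbation_id (hpost.preimage_mem_nhds
    (by rwa [ContinuousMap.comp_id]))
  refine ⟨δ, hδ, fun P hP m => ?_⟩
  by_contra! hzero
  obtain ⟨h, hhW, hh⟩ := hpert (fun i : Fin m => forwardOrbit f x i)
    (fun i j hij => Fin.ext (hinj hij)) (fun i => P i) (fun i => hP i)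
  let g : End1 M := f.comp h
  have hTg : tangentMap (𝓡 2) (𝓡 2) g =
      tangentMap (𝓡 2) (𝓡 2) f ∘ tangentMap (𝓡 2) (𝓡 2) h :=
    tangentMap_comp (f.contMDiff.mdifferentiable one_ne_zero)
      (h.contMDiff.mdifferentiable one_ne_zero)
  have hgt : g ∈ t := by
    refine hWt ?_
    have h1 : tangentMapC g = (tangentMapC f).comp (tangentMapC h) :=
      ContinuousMap.ext fun p => congrFun hTg p
    rw [mem_preimage, h1]
    exact hhW
  refine Set.notMem_empty g (hempty ▸ ⟨hgt, ?_⟩)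
  refine hasFullDimensionalKernel_of_forall (n := m) (x := x) fun v => ?_
  let w : ∀ i, TangentSpace (𝓡 2) (forwardOrbit f x i) := fun i =>
    Nat.rec (motive := fun i => TangentSpace (𝓡 2) (forwardOrbit f x i)) v
      (fun i u => mfderiv (𝓡 2) (𝓡 2) f (forwardOrbit f x i) (u + P i u)) i
  have hit : ∀ i, i ≤ m → (tangentMap (𝓡 2) (𝓡 2) g)^[i] ⟨x, v⟩ = ⟨forwardOrbit f x i, w i⟩ := by
    intro i
    induction i with
    | zero => intro _; rfl
    | succ i ih =>
      intro hi
      rw [Function.iterate_succ_apply', ih (by omega), hTg, Function.comp_apply,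
        hh ⟨i, by omega⟩ (w i)]
      rfl
  have h1 := hit m le_rfl
  rw [hzero w fun i => rfl, ← tangentMap_iterate] at h1
  unfold tangentMap at h1
  rw [Bundle.TotalSpace.mk.injEq] at h1
  exact eq_of_heq h1.2

end ForwardOrbit

/-! ### Limits in Riemannian vector bundles -/

section BundleLimits

open Filter Bundle

variable {B : Type*} [TopologicalSpace B] {F : Type*} [NormedAddCommGroup F]
  {E : B → Type*} [TopologicalSpace (TotalSpace F E)] [∀ x, NormedAddCommGroup (E x)]
  [FiberBundle F E]
  {J : Type*} {l : Filter J} {b : J → B} {v w : ∀ j, E (b j)} {x : B} {v₀ w₀ : E x}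

theorem tendsto_mk_iff :
    Tendsto (fun j => (⟨b j, v j⟩ : TotalSpace F E)) l (𝓝 ⟨x, v₀⟩) ↔ Tendsto b l (𝓝 x) ∧
      Tendsto (fun j => (trivializationAt F E x ⟨b j, v j⟩).2) l
        (𝓝 (trivializationAt F E x ⟨x, v₀⟩).2) :=
  (trivializationAt F E x).tendsto_nhds_iff
    ((trivializationAt F E x).mem_source.2 (FiberBundle.mem_baseSet_trivializationAt' x))

theorem eventually_mem_baseSet (hb : Tendsto b l (𝓝 x)) :
    ∀ᶠ j in l, b j ∈ (trivializationAt F E x).baseSet :=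
  hb.eventually_mem ((trivializationAt F E x).open_baseSet.mem_nhds
    (FiberBundle.mem_baseSet_trivializationAt' x))

theorem tendsto_totalSpace_unique [T2Space B] [l.NeBot] {g : J → TotalSpace F E}
    {p q : TotalSpace F E} (hp : Tendsto g l (𝓝 p)) (hq : Tendsto g l (𝓝 q)) : p = q := by
  have hcont := FiberBundle.continuous_proj F E
  have hpq : p.proj = q.proj :=
    tendsto_nhds_unique ((hcont.tendsto p).comp hp) ((hcont.tendsto q).comp hq)
  set e := trivializationAt F E p.proj with he
  have hps : p ∈ e.source := e.mem_source.2 (FiberBundle.mem_baseSet_trivializationAt' _)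
  have hqs : q ∈ e.source :=
    e.mem_source.2 (hpq ▸ FiberBundle.mem_baseSet_trivializationAt' p.proj)
  refine e.injOn hps hqs (Prod.ext ?_ ?_)
  · exact (e.coe_fst hps).trans (hpq.trans (e.coe_fst hqs).symm)
  · exact tendsto_nhds_unique ((e.tendsto_nhds_iff hps).1 hp).2 ((e.tendsto_nhds_iff hqs).1 hq).2

/-- The section of `E` which is constant in the trivialization at `x` is continuous near `x`. -/
theorem tendsto_mk_symm {y : J → F} {y₀ : F} {x' : B}
    (hx' : x' ∈ (trivializationAt F E x).baseSet) (hb : Tendsto b l (𝓝 x'))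
    (hy : Tendsto y l (𝓝 y₀)) :
    Tendsto (fun j => (⟨b j, (trivializationAt F E x).symm (b j) (y j)⟩ : TotalSpace F E)) l
      (𝓝 ⟨x', (trivializationAt F E x).symm x' y₀⟩) := by
  rw [(trivializationAt F E x).tendsto_nhds_iff ((trivializationAt F E x).mem_source.2 hx')]
  refine ⟨hb, ?_⟩
  rw [Trivialization.apply_mk_symm _ hx']
  refine hy.congr' ?_
  filter_upwards [hb.eventually_mem ((trivializationAt F E x).open_baseSet.mem_nhds hx')]
    with j hj
  rw [Trivialization.apply_mk_symm _ hj]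

variable [NormedSpace ℝ F] [∀ x, InnerProductSpace ℝ (E x)] [VectorBundle ℝ F E]

theorem tendsto_mk_smul {c : J → ℝ} {c₀ : ℝ} (hc : Tendsto c l (𝓝 c₀))
    (hv : Tendsto (fun j => (⟨b j, v j⟩ : TotalSpace F E)) l (𝓝 ⟨x, v₀⟩)) :
    Tendsto (fun j => (⟨b j, c j • v j⟩ : TotalSpace F E)) l (𝓝 ⟨x, c₀ • v₀⟩) := by
  rw [tendsto_mk_iff] at hv ⊢
  have hlin : ∀ y ∈ (trivializationAt F E x).baseSet, ∀ (a : ℝ) (u : E y),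
      (trivializationAt F E x ⟨y, a • u⟩).2 = a • (trivializationAt F E x ⟨y, u⟩).2 :=
    fun y hy a u => ((trivializationAt F E x).linear ℝ hy).map_smul a u
  refine ⟨hv.1, ?_⟩
  rw [hlin x (FiberBundle.mem_baseSet_trivializationAt' x)]
  refine (hc.smul hv.2).congr' ?_
  filter_upwards [eventually_mem_baseSet (F := F) (E := E) hv.1] with j hj
  rw [hlin _ hj]

theorem exists_tendsto_of_norm_le [IsContinuousRiemannianBundle F E] [ProperSpace F]
    {l : Ultrafilter J} (hb : Tendsto b l (𝓝 x)) {C : ℝ} (hv : ∀ᶠ j in l, ‖v j‖ ≤ C) :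
    ∃ v₀ : E x, Tendsto (fun j => (⟨b j, v j⟩ : TotalSpace F E)) l (𝓝 ⟨x, v₀⟩) := by
  set e := trivializationAt F E x with he
  have hx : x ∈ e.baseSet := FiberBundle.mem_baseSet_trivializationAt' x
  obtain ⟨K, hK, hK'⟩ := eventually_norm_trivializationAt_lt F E x
  have hbd : ∀ᶠ j in l, (e ⟨b j, v j⟩).2 ∈ Metric.closedBall (0 : F) (K * C) := by
    filter_upwards [hb.eventually hK', hv, eventually_mem_baseSet (F := F) (E := E) hb]
      with j h1 h2 h3
    have h4 : (e ⟨b j, v j⟩).2 = e.continuousLinearMapAt ℝ (b j) (v j) := by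
      rw [Trivialization.continuousLinearMapAt_apply, Trivialization.linearMapAt_apply, if_pos h3]
    rw [mem_closedBall_zero_iff, h4]
    exact (ContinuousLinearMap.le_opNorm _ _).trans (mul_le_mul h1.le h2 (norm_nonneg _) hK.le)
  obtain ⟨u, -, hu⟩ := (isCompact_closedBall (0 : F) (K * C)).ultrafilter_le_nhds
    (l.map fun j => (e ⟨b j, v j⟩).2) (by rw [le_principal_iff]; exact hbd)
  refine ⟨e.symm x u, tendsto_mk_iff.2 ⟨hb, ?_⟩⟩
  rw [← he, Trivialization.apply_mk_symm _ hx]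
  exact hu

theorem tendsto_inner_of_tendsto_mk [IsContinuousRiemannianBundle F E]
    (hv : Tendsto (fun j => (⟨b j, v j⟩ : TotalSpace F E)) l (𝓝 ⟨x, v₀⟩))
    (hw : Tendsto (fun j => (⟨b j, w j⟩ : TotalSpace F E)) l (𝓝 ⟨x, w₀⟩)) :
    Tendsto (fun j => inner ℝ (v j) (w j)) l (𝓝 (inner ℝ v₀ w₀)) := by
  set e := trivializationAt F E x with he
  have hx : x ∈ e.baseSet := FiberBundle.mem_baseSet_trivializationAt' x
  have hmk : ∀ y ∈ e.baseSet, ∀ u : E y, e.symm y (e ⟨y, u⟩).2 = u := fun y hy u =>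
    e.symm_apply_apply_mk hy u
  -- the inner product in the trivialization at `x`
  have hG : ContinuousAt (fun m : B × F × F =>
      inner ℝ (e.symm m.1 m.2.1) (e.symm m.1 m.2.2)) (x, (e ⟨x, v₀⟩).2, (e ⟨x, w₀⟩).2) := by
    refine ContinuousAt.inner_bundle (F := F) (b := fun m : B × F × F => m.1) ?_ ?_
    · exact tendsto_mk_symm (b := fun m : B × F × F => m.1) hx continuousAt_fst
        (continuousAt_fst.comp continuousAt_snd)
    · exact tendsto_mk_symm (b := fun m : B × F × F => m.1) hx continuousAt_fst
        (continuousAt_snd.comp continuousAt_snd)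
  have hb := (tendsto_mk_iff.1 hv).1
  have h1 := hG.tendsto.comp (hb.prodMk_nhds
    ((tendsto_mk_iff.1 hv).2.prodMk_nhds (tendsto_mk_iff.1 hw).2))
  simp only [hmk x hx] at h1
  refine h1.congr' ?_
  filter_upwards [eventually_mem_baseSet (F := F) (E := E) hb] with j hj
  simp only [Function.comp, ← he, hmk _ hj]

theorem tendsto_norm_of_tendsto_mk [IsContinuousRiemannianBundle F E]
    (hv : Tendsto (fun j => (⟨b j, v j⟩ : TotalSpace F E)) l (𝓝 ⟨x, v₀⟩)) :
    Tendsto (fun j => ‖v j‖) l (𝓝 ‖v₀‖) := by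
  have h1 := (tendsto_inner_of_tendsto_mk hv hv).sqrt
  simpa only [real_inner_self_eq_norm_sq, Real.sqrt_sq (norm_nonneg _)] using h1

end BundleLimits

/-! ### Uniqueness of dominated lines: linear algebra -/

section UniquenessAlgebra

theorem eq_zero_of_forall_le_pow {a C : ℝ} (ha : 0 ≤ a) (h : ∀ k : ℕ, a ≤ (1 / 2) ^ k * C) :
    a = 0 := by
  refine le_antisymm (ge_of_tendsto' (x := Filter.atTop) (f := fun k : ℕ => (1 / 2 : ℝ) ^ k * C) ?_ h) ha
  simpa using (tendsto_pow_atTop_nhds_zero_of_lt_one (r := (1 / 2 : ℝ)) (by norm_num)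
    (by norm_num)).mul_const C

variable {V W : Type*} [NormedAddCommGroup V] [InnerProductSpace ℝ V] [NormedAddCommGroup W]
  [NormedSpace ℝ W]

theorem exists_eq_smul_add_smul (hV : finrank ℝ V = 2) {e u : V} {δ : ℝ} (hδ : 0 < δ)
    (he : ‖e‖ = 1) (hu : ‖u‖ = 1) (heu : inner ℝ e u ^ 2 ≤ 1 - δ ^ 2) (v : V) :
    ∃ p q : ℝ, v = p • e + q • u := by
  have he0 : e ≠ 0 := norm_pos_iff.1 (by rw [he]; exact one_pos)
  have htop : Submodule.span ℝ {e, u} = ⊤ := by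
    by_contra hne
    have h1 := eq_span_singleton_of_finrank_two hV hne he0 (Submodule.subset_span (by simp))
    have h2 : u ∈ Submodule.span ℝ {e, u} := Submodule.subset_span (by simp)
    rw [h1, Submodule.mem_span_singleton] at h2
    obtain ⟨c, rfl⟩ := h2
    rw [norm_smul, he, mul_one, Real.norm_eq_abs] at hu
    rw [inner_smul_right, real_inner_self_eq_norm_sq, he, one_pow, mul_one, ← sq_abs, hu] at heu
    nlinarith
  obtain ⟨p, q, h⟩ := Submodule.mem_span_pair.1 (htop ▸ Submodule.mem_top : v ∈ _)
  exact ⟨p, q, h.symm⟩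

/-- The dominated line is unique: a vector off the line of `e` grows like `u`, hence at least as
fast as any other vector, so it cannot be dominated by another vector `u'`. -/
theorem dominated_line_unique {e u e' u' : V} (hspan : ∀ v, ∃ p q : ℝ, v = p • e + q • u)
    (N : ℕ → Seminorm ℝ V) (hpos : ∀ k, 0 < N k u) (h : ∀ k, N k e ≤ (1 / 2) ^ k * N k u)
    (h' : ∀ k, N k e' ≤ (1 / 2) ^ k * N k u') : ∃ p : ℝ, e' = p • e := by
  obtain ⟨p, q, hpq⟩ := hspan e'
  obtain ⟨r, s, hrs⟩ := hspan u'
  have hq : |q| = 0 := by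
    refine eq_zero_of_forall_le_pow (C := |r| + |s| + |p|) (abs_nonneg q) fun k => ?_
    have h1 : |q| * N k u ≤ N k e' + |p| * N k e := by
      have : q • u = e' - p • e := by rw [hpq]; abel
      have h2 := map_sub_le_add (N k) e' (p • e)
      rw [← this] at h2
      simpa [map_smul_eq_mul] using h2
    have h2 : N k u' ≤ |r| * N k e + |s| * N k u := by
      have h3 := map_add_le_add (N k) (r • e) (s • u)
      rw [← hrs] at h3
      simpa [map_smul_eq_mul] using h3
    have h3 : N k e ≤ N k u := (h k).trans
      (mul_le_of_le_one_left (hpos k).le (pow_le_one₀ (by norm_num) (by norm_num)))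
    refine le_of_mul_le_mul_right ?_ (hpos k)
    calc |q| * N k u ≤ N k e' + |p| * N k e := h1
      _ ≤ (1 / 2) ^ k * (|r| * N k u + |s| * N k u) + |p| * ((1 / 2) ^ k * N k u) := by
        refine add_le_add ((h' k).trans ?_) (mul_le_mul_of_nonneg_left (h k) (abs_nonneg p))
        refine mul_le_mul_of_nonneg_left (h2.trans ?_) (by positivity)
        gcongr
      _ = (1 / 2) ^ k * (|r| + |s| + |p|) * N k u := by ring
  rw [abs_eq_zero] at hq
  exact ⟨p, by rw [hpq, hq, zero_smul, add_zero]⟩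

/-- The image of a line transverse to the dominated line `e` is close to the image of `u`. -/
theorem exists_norm_sub_smul_le {e u u' : V} {δ : ℝ} (hδ : 0 < δ) (he : ‖e‖ = 1) (hu : ‖u‖ = 1)
    (hu' : ‖u'‖ = 1) (heu : inner ℝ e u ^ 2 ≤ 1 - δ ^ 2) (heu' : inner ℝ e u' ^ 2 ≤ 1 - δ ^ 2)
    (hspan : ∀ v, ∃ p q : ℝ, v = p • e + q • u) (L : V →L[ℝ] W) {ε γ γ' : ℝ} {w w' : W}
    (hw : ‖w‖ = 1) (hγ : γ ≠ 0) (hLu : L u = γ • w) (hLu' : L u' = γ' • w')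
    (hLe : ‖L e‖ ≤ ε * ‖L u‖) : ∃ c : ℝ, ‖w - c • w'‖ ≤ ε * ((1 + 1 / δ) / δ) := by
  obtain ⟨r, s, hrs⟩ := hspan u'
  obtain ⟨φ, hφ1, hφ0, hφ⟩ := exists_coord_norm_le hδ hu he (by rwa [real_inner_comm])
  obtain ⟨φ', hφ1', hφ0', hφ'⟩ := exists_coord_norm_le hδ hu' he (by rwa [real_inner_comm])
  have hs : |s| ≤ 1 / δ := by
    have h1 : φ u' = s := by simp [hrs, hφ1, hφ0]
    have h2 := φ.le_opNorm u'
    rw [h1, hu', mul_one, Real.norm_eq_abs] at h2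
    exact h2.trans hφ
  have hs' : δ ≤ |s| := by
    have h1 : s * φ' u = 1 := by
      rw [← hφ1', hrs, map_add, map_smul, map_smul, hφ0']
      simp
    have h2 := φ'.le_opNorm u
    rw [hu, mul_one, Real.norm_eq_abs] at h2
    have h3 : |s| * |φ' u| = 1 := by rw [← abs_mul, h1, abs_one]
    have h4 : |s| * |φ' u| ≤ |s| * (1 / δ) :=
      mul_le_mul_of_nonneg_left (h2.trans hφ') (abs_nonneg s)
    rw [h3, mul_one_div, le_div_iff₀ hδ] at h4
    linarith
  have hr : |r| ≤ 1 + 1 / δ := by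
    have h1 : r • e = u' - s • u := by rw [hrs]; abel
    have h2 := norm_sub_le u' (s • u)
    rw [← h1, norm_smul, norm_smul, he, hu, hu', mul_one, mul_one, Real.norm_eq_abs,
      Real.norm_eq_abs] at h2
    linarith
  have hs0 : s ≠ 0 := abs_pos.1 (hδ.trans_le hs')
  refine ⟨(s * γ)⁻¹ * γ', ?_⟩
  have h1 : w - ((s * γ)⁻¹ * γ') • w' = -((s * γ)⁻¹ * r) • L e := by
    have h2 : γ' • w' = r • L e + (s * γ) • w := by
      rw [← hLu', hrs, map_add, map_smul, map_smul, hLu, smul_smul]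
    rw [mul_smul, h2, smul_add, smul_smul, inv_smul_smul₀ (mul_ne_zero hs0 hγ)]
    module
  rw [hLu, norm_smul, hw, mul_one, Real.norm_eq_abs] at hLe
  have hγ' : 0 < |γ| := abs_pos.2 hγ
  have hε : 0 ≤ ε := by
    by_contra! hlt
    nlinarith [norm_nonneg (L e)]
  rw [h1, norm_smul, norm_neg, norm_mul, norm_inv, norm_mul, Real.norm_eq_abs, Real.norm_eq_abs,
    Real.norm_eq_abs]
  calc (|s| * |γ|)⁻¹ * |r| * ‖L e‖ ≤ (|s| * |γ|)⁻¹ * |r| * (ε * |γ|) := by gcongr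
    _ = ε * (|r| / |s|) := by field_simp
    _ ≤ ε * ((1 + 1 / δ) / δ) := by gcongr

theorem eq_smul_of_forall_norm_sub_smul_le {w w' : V} {C : ℝ}
    (h : ∀ k : ℕ, ∃ c : ℝ, ‖w - c • w'‖ ≤ (1 / 2) ^ k * C) : ∃ c : ℝ, w = c • w' := by
  have hcl : IsClosed (Submodule.span ℝ {w'} : Set V) := Submodule.closed_of_finiteDimensional _
  have hmem : w ∈ (Submodule.span ℝ {w'} : Set V) := by
    rw [← hcl.closure_eq, Metric.mem_closure_iff]
    intro ε hε
    have h1 : Filter.Tendsto (fun k : ℕ => (1 / 2 : ℝ) ^ k * C) Filter.atTop (𝓝 0) := by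
      simpa using (tendsto_pow_atTop_nhds_zero_of_lt_one (r := (1 / 2 : ℝ)) (by norm_num)
        (by norm_num)).mul_const C
    obtain ⟨k, hk⟩ := (h1.eventually_lt_const hε).exists
    obtain ⟨c, hc⟩ := h k
    exact ⟨c • w', Submodule.smul_mem _ _ (Submodule.mem_span_singleton_self _),
      by rw [dist_eq_norm]; exact hc.trans_lt hk⟩
  obtain ⟨c, hc⟩ := Submodule.mem_span_singleton.1 hmem
  exact ⟨c, hc.symm⟩

end UniquenessAlgebra

/-! ### Dominated frames along full orbits -/

section DominatedFrames

open Filter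

variable {M : Type*} [TopologicalSpace M] [ChartedSpace (EuclideanSpace ℝ (Fin 2)) M]

theorem tangentMap_smul_of_eq {h : M → M} {y y' : M} {v : TangentSpace (𝓡 2) y}
    {v' : TangentSpace (𝓡 2) y'}
    (hv : tangentMap (𝓡 2) (𝓡 2) h ⟨y, v⟩ = (⟨y', v'⟩ : TangentBundle (𝓡 2) M)) (c : ℝ) :
    tangentMap (𝓡 2) (𝓡 2) h ⟨y, c • v⟩ = (⟨y', c • v'⟩ : TangentBundle (𝓡 2) M) := by
  obtain rfl : h y = y' := congrArg Bundle.TotalSpace.proj hv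
  obtain rfl : mfderiv (𝓡 2) (𝓡 2) h y v = v' := by
    unfold tangentMap at hv
    rw [Bundle.TotalSpace.mk.injEq] at hv
    exact eq_of_heq hv.2
  exact congrArg (Bundle.TotalSpace.mk (h y)) ((mfderiv (𝓡 2) (𝓡 2) h y).map_smul c v)

theorem exists_continuousLinearMap_tangentMap_iterate (f : End1 M) (n : ℕ) {y y' : M}
    (h : f^[n] y = y') : ∃ L : TangentSpace (𝓡 2) y →L[ℝ] TangentSpace (𝓡 2) y',
      ∀ v, tangentMap (𝓡 2) (𝓡 2) (f^[n] : M → M) ⟨y, v⟩ = ⟨y', L v⟩ := by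
  subst h
  exact ⟨derivIter f n y, fun v => rfl⟩

theorem continuous_tangentMap_iterate [IsManifold (𝓡 2) ∞ M] (f : End1 M) (n : ℕ) :
    Continuous (tangentMap (𝓡 2) (𝓡 2) (f^[n] : M → M)) := by
  rw [tangentMap_iterate]
  exact (tangentMapC f).continuous.iterate n

theorem exists_tangentMap_iterate_eq {f : End1 M} {x : ℤ → M} {e : ∀ i, TangentSpace (𝓡 2) (x i)}
    (h : ∀ i, ∃ c : ℝ, tangentMap (𝓡 2) (𝓡 2) f ⟨x i, e i⟩ = ⟨x (i + 1), c • e (i + 1)⟩)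
    (i : ℤ) (n : ℕ) : ∃ c : ℝ, tangentMap (𝓡 2) (𝓡 2) (f^[n] : M → M) ⟨x i, e i⟩ =
      ⟨x (i + n), c • e (i + n)⟩ := by
  rw [tangentMap_iterate]
  induction n with
  | zero =>
    refine ⟨1, ?_⟩
    rw [one_smul, show i + ((0 : ℕ) : ℤ) = i by simp]
    rfl
  | succ n ih =>
    obtain ⟨c, hc⟩ := ih
    obtain ⟨c', hc'⟩ := h (i + n)
    refine ⟨c * c', ?_⟩
    rw [Function.iterate_succ_apply', hc, tangentMap_smul_of_eq hc', smul_smul]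
    rw [show i + ((n + 1 : ℕ) : ℤ) = i + n + 1 by push_cast; ring]

variable [Bundle.RiemannianBundle (fun x : M => TangentSpace (𝓡 2) x)]

/-- At the index `i`, the unit vectors `e i` and `u i`, at the point `x i` of the sequence `x`,
span two lines with angle bounded from below in terms of `δ`, which are mapped by `Df` into the
corresponding lines of index `i + 1`, and the second one dominates the first one under `Df^ℓ`.

The invariance is an equality in the tangent bundle, as `f (x i)` and `x (i + 1)` are equal but not
by definition. -/
structure IsDominatedFrameAt (f : End1 M) (δ : ℝ) (ℓ : ℕ) (x : ℤ → M)
    (e u : ∀ i, TangentSpace (𝓡 2) (x i)) (i : ℤ) : Prop where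
  norm_e : ‖e i‖ = 1
  norm_u : ‖u i‖ = 1
  inner_sq_le : inner ℝ (e i) (u i) ^ 2 ≤ 1 - δ ^ 2
  map_e : ∃ c : ℝ, tangentMap (𝓡 2) (𝓡 2) f ⟨x i, e i⟩ = ⟨x (i + 1), c • e (i + 1)⟩
  map_u : ∃ c : ℝ, tangentMap (𝓡 2) (𝓡 2) f ⟨x i, u i⟩ = ⟨x (i + 1), c • u (i + 1)⟩
  dom : ‖derivIter f ℓ (x i) (e i)‖ ≤ 1 / 2 * ‖derivIter f ℓ (x i) (u i)‖

variable {f : End1 M} {δ : ℝ} {ℓ : ℕ} {x : ℤ → M} {e u e' u' : ∀ i, TangentSpace (𝓡 2) (x i)}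

theorem norm_derivIter_eq_of_tangentMap_eq {n : ℕ} {y y' : M} {v : TangentSpace (𝓡 2) y}
    {v' : TangentSpace (𝓡 2) y'}
    (h : tangentMap (𝓡 2) (𝓡 2) (f^[n] : M → M) ⟨y, v⟩ = (⟨y', v'⟩ : TangentBundle (𝓡 2) M)) :
    ‖derivIter f n y v‖ = ‖v'‖ :=
  congrArg (fun p : TangentBundle (𝓡 2) M => ‖p.2‖) h

theorem norm_derivIter_add {m n : ℕ} {y y' : M} {v : TangentSpace (𝓡 2) y}
    {v' : TangentSpace (𝓡 2) y'} {c : ℝ}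
    (h : tangentMap (𝓡 2) (𝓡 2) (f^[m] : M → M) ⟨y, v⟩ =
      (⟨y', c • v'⟩ : TangentBundle (𝓡 2) M)) :
    ‖derivIter f (n + m) y v‖ = |c| * ‖derivIter f n y' v'‖ := by
  have h1 : tangentMap (𝓡 2) (𝓡 2) (f^[n + m] : M → M) ⟨y, v⟩ =
      ⟨f^[n] y', c • derivIter f n y' v'⟩ := by
    rw [tangentMap_iterate, Function.iterate_add_apply, ← tangentMap_iterate f m, h,
      ← tangentMap_iterate f n]
    exact tangentMap_smul_of_eq rfl c
  rw [norm_derivIter_eq_of_tangentMap_eq h1, norm_smul, Real.norm_eq_abs]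

theorem norm_derivIter_mul_le (h : ∀ i, IsDominatedFrameAt f δ ℓ x e u i) (i : ℤ) (k : ℕ) :
    ‖derivIter f (k * ℓ) (x i) (e i)‖ ≤ (1 / 2) ^ k * ‖derivIter f (k * ℓ) (x i) (u i)‖ := by
  induction k generalizing i with
  | zero =>
    have h0 : ∀ v : TangentSpace (𝓡 2) (x i), ‖derivIter f (0 * ℓ) (x i) v‖ = ‖v‖ := fun v =>
      norm_derivIter_eq_of_tangentMap_eq (by
        rw [zero_mul, Function.iterate_zero, tangentMap_id]; rfl)
    rw [h0, h0, (h i).norm_e, (h i).norm_u]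
    norm_num
  | succ k ih =>
    obtain ⟨β, hβ⟩ := exists_tangentMap_iterate_eq (fun i => (h i).map_e) i ℓ
    obtain ⟨γ, hγ⟩ := exists_tangentMap_iterate_eq (fun i => (h i).map_u) i ℓ
    have hβγ := (h i).dom
    rw [norm_derivIter_eq_of_tangentMap_eq hβ, norm_derivIter_eq_of_tangentMap_eq hγ, norm_smul,
      norm_smul, (h _).norm_e, (h _).norm_u, mul_one, mul_one, Real.norm_eq_abs,
      Real.norm_eq_abs] at hβγ
    rw [add_mul, one_mul, norm_derivIter_add hβ, norm_derivIter_add hγ]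
    calc |β| * ‖derivIter f (k * ℓ) (x (i + ℓ)) (e (i + ℓ))‖
        ≤ (1 / 2 * |γ|) * ((1 / 2) ^ k * ‖derivIter f (k * ℓ) (x (i + ℓ)) (u (i + ℓ))‖) :=
          mul_le_mul hβγ (ih _) (norm_nonneg _) (by positivity)
      _ = (1 / 2) ^ (k + 1) * (|γ| * ‖derivIter f (k * ℓ) (x (i + ℓ)) (u (i + ℓ))‖) := by ring

/-- If `Df^(kℓ)` vanished on the dominating vector, it would vanish on the dominated one as well,
hence on the whole tangent plane. -/
theorem norm_derivIter_pos (hδ : 0 < δ) (hnz : ∀ n y, ∃ v, derivIter f n y v ≠ 0)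
    (h : ∀ i, IsDominatedFrameAt f δ ℓ x e u i) (i : ℤ) (k : ℕ) :
    0 < ‖derivIter f (k * ℓ) (x i) (u i)‖ := by
  rw [norm_pos_iff]
  intro h0
  have h1 := norm_derivIter_mul_le h i k
  rw [h0, norm_zero, mul_zero, norm_le_zero_iff] at h1
  obtain ⟨v, hv⟩ := hnz (k * ℓ) (x i)
  obtain ⟨p, q, rfl⟩ := exists_eq_smul_add_smul (finrank_tangentSpace (x i)) hδ (h i).norm_e
    (h i).norm_u (h i).inner_sq_le v
  apply hv
  rw [map_add, map_smul, map_smul, h0, h1, smul_zero, smul_zero, add_zero]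

/-- The dominated line is determined by the future: it consists of the vectors whose growth is
dominated. -/
theorem exists_eq_smul_e (hδ : 0 < δ) (hnz : ∀ n y, ∃ v, derivIter f n y v ≠ 0)
    (h : ∀ i, IsDominatedFrameAt f δ ℓ x e u i) (h' : ∀ i, IsDominatedFrameAt f δ ℓ x e' u' i)
    (i : ℤ) : ∃ c : ℝ, e' i = c • e i :=
  dominated_line_unique (exists_eq_smul_add_smul (finrank_tangentSpace (x i)) hδ (h i).norm_e
    (h i).norm_u (h i).inner_sq_le)
    (fun k => (normSeminorm ℝ (TangentSpace (𝓡 2) (f^[k * ℓ] (x i)))).comp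
      (derivIter f (k * ℓ) (x i)).toLinearMap)
    (fun k => norm_derivIter_pos hδ hnz h i k) (fun k => norm_derivIter_mul_le h i k)
    (fun k => norm_derivIter_mul_le h' i k)

/-- The dominating line is determined by the past: at time `i - k ℓ` the lines of `u` and `u'` are
both transverse to the common dominated line, so at time `i` their distance is of order
`2 ^ (-k)`. -/
theorem exists_eq_smul_u (hδ : 0 < δ) (hnz : ∀ n y, ∃ v, derivIter f n y v ≠ 0)
    (h : ∀ i, IsDominatedFrameAt f δ ℓ x e u i) (h' : ∀ i, IsDominatedFrameAt f δ ℓ x e' u' i)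
    (i : ℤ) : ∃ c : ℝ, u i = c • u' i := by
  refine eq_smul_of_forall_norm_sub_smul_le (C := (1 + 1 / δ) / δ) fun k => ?_
  -- the comparison takes place at time `i - k ℓ`
  obtain ⟨j, hj⟩ : ∃ j : ℤ, j + ((k * ℓ : ℕ) : ℤ) = i := ⟨i - ((k * ℓ : ℕ) : ℤ), by ring⟩
  obtain ⟨γ, hγ⟩ := exists_tangentMap_iterate_eq (fun i => (h i).map_u) j (k * ℓ)
  obtain ⟨γ', hγ'⟩ := exists_tangentMap_iterate_eq (fun i => (h' i).map_u) j (k * ℓ)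
  rw [hj] at hγ hγ'
  obtain ⟨L, hL⟩ := exists_continuousLinearMap_tangentMap_iterate f (k * ℓ)
    (congrArg Bundle.TotalSpace.proj hγ)
  have hLn : ∀ v, ‖derivIter f (k * ℓ) (x j) v‖ = ‖L v‖ := fun v =>
    norm_derivIter_eq_of_tangentMap_eq (hL v)
  have hLu : L (u j) = γ • u i := by
    have h1 := (hL (u j)).symm.trans hγ
    rw [Bundle.TotalSpace.mk.injEq] at h1
    exact eq_of_heq h1.2
  have hLu' : L (u' j) = γ' • u' i := by
    have h1 := (hL (u' j)).symm.trans hγ'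
    rw [Bundle.TotalSpace.mk.injEq] at h1
    exact eq_of_heq h1.2
  have hγ0 : γ ≠ 0 := by
    rintro rfl
    have h1 := norm_derivIter_pos hδ hnz h j k
    rw [hLn, hLu, zero_smul, norm_zero] at h1
    exact h1.false
  have hle := norm_derivIter_mul_le h j k
  rw [hLn, hLn] at hle
  obtain ⟨c, hc⟩ := exists_eq_smul_e hδ hnz h h' j
  have hc1 : c ^ 2 = 1 := by
    have h1 := (h' j).norm_e
    rw [hc, norm_smul, (h j).norm_e, mul_one, Real.norm_eq_abs] at h1
    rw [← sq_abs, h1, one_pow]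
  have heu' : inner ℝ (e j) (u' j) ^ 2 ≤ 1 - δ ^ 2 := by
    have h1 := (h' j).inner_sq_le
    rw [hc, inner_smul_left, mul_pow] at h1
    simpa [hc1] using h1
  exact exists_norm_sub_smul_le hδ (h j).norm_e (h j).norm_u (h' j).norm_u (h j).inner_sq_le heu'
    (exists_eq_smul_add_smul (finrank_tangentSpace (x j)) hδ (h j).norm_e (h j).norm_u
      (h j).inner_sq_le) L (h i).norm_u hγ0 hLu hLu' hle

variable [IsManifold (𝓡 2) ∞ M] [IsContinuousRiemannianBundle (EuclideanSpace ℝ (Fin 2))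
      (fun x : M => TangentSpace (𝓡 2) x)]

/-- The coefficients of `Df` in unit frames are bounded, so the invariance of lines passes to
limits. -/
theorem exists_limit_map_eq [T2Space M] {J : Type*} {l : Ultrafilter J} {y : J → ℤ → M}
    {e : ∀ j i, TangentSpace (𝓡 2) (y j i)} {x : ℤ → M} {e' : ∀ i, TangentSpace (𝓡 2) (x i)}
    {i : ℤ} (hmap : ∀ᶠ j in l, ∃ c : ℝ,
      tangentMap (𝓡 2) (𝓡 2) f ⟨y j i, e j i⟩ = ⟨y j (i + 1), c • e j (i + 1)⟩)
    (hnorm : ∀ᶠ j in l, ‖e j (i + 1)‖ = 1)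
    (hi : Tendsto (fun j => (⟨y j i, e j i⟩ : TangentBundle (𝓡 2) M)) l (𝓝 ⟨x i, e' i⟩))
    (hi' : Tendsto (fun j => (⟨y j (i + 1), e j (i + 1)⟩ : TangentBundle (𝓡 2) M)) l
      (𝓝 ⟨x (i + 1), e' (i + 1)⟩)) :
    ∃ c : ℝ, tangentMap (𝓡 2) (𝓡 2) f ⟨x i, e' i⟩ = ⟨x (i + 1), c • e' (i + 1)⟩ := by
  have hc : ∀ j, ∃ c : ℝ, (∃ c : ℝ, tangentMap (𝓡 2) (𝓡 2) f ⟨y j i, e j i⟩ =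
      ⟨y j (i + 1), c • e j (i + 1)⟩) → tangentMap (𝓡 2) (𝓡 2) f ⟨y j i, e j i⟩ =
      ⟨y j (i + 1), c • e j (i + 1)⟩ := by
    intro j
    by_cases h : ∃ c : ℝ, tangentMap (𝓡 2) (𝓡 2) f ⟨y j i, e j i⟩ =
      ⟨y j (i + 1), c • e j (i + 1)⟩
    · obtain ⟨c, hc⟩ := h
      exact ⟨c, fun _ => hc⟩
    · exact ⟨0, fun h' => absurd h' h⟩
  choose c hc using hc
  have hTf : Tendsto (fun j => tangentMap (𝓡 2) (𝓡 2) f ⟨y j i, e j i⟩) l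
      (𝓝 (tangentMap (𝓡 2) (𝓡 2) f ⟨x i, e' i⟩)) :=
    ((tangentMapC f).continuous.tendsto _).comp hi
  have hTn : Tendsto (fun j => ‖(tangentMap (𝓡 2) (𝓡 2) f ⟨y j i, e j i⟩).2‖) l
      (𝓝 ‖(tangentMap (𝓡 2) (𝓡 2) f ⟨x i, e' i⟩).2‖) :=
    tendsto_norm_of_tendsto_mk hTf
  set K := ‖(tangentMap (𝓡 2) (𝓡 2) f ⟨x i, e' i⟩).2‖
  have hbd : ∀ᶠ j in l, c j ∈ Metric.closedBall (0 : ℝ) (K + 1) := by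
    filter_upwards [hmap, hnorm, hTn.eventually_le_const (lt_add_one K)] with j h1 h2 h3
    rw [hc j h1, norm_smul, h2, mul_one] at h3
    rwa [mem_closedBall_zero_iff]
  obtain ⟨c₀, -, hc₀⟩ := (isCompact_closedBall (0 : ℝ) (K + 1)).ultrafilter_le_nhds (l.map c)
    (by rw [le_principal_iff]; exact hbd)
  refine ⟨c₀, tendsto_totalSpace_unique hTf ((tendsto_mk_smul hc₀ hi').congr' ?_)⟩
  filter_upwards [hmap] with j hj
  exact (hc j hj).symm

/-- Being a dominated frame is a closed condition, and unit frames have limits. -/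
theorem exists_limit_frame [T2Space M] {J : Type*} {l : Ultrafilter J} {y : J → ℤ → M}
    {e u : ∀ j i, TangentSpace (𝓡 2) (y j i)} {x : ℤ → M}
    (hy : ∀ i, Tendsto (fun j => y j i) l (𝓝 (x i)))
    (h : ∀ i, ∀ᶠ j in l, IsDominatedFrameAt f δ ℓ (y j) (e j) (u j) i) :
    ∃ e' u' : ∀ i, TangentSpace (𝓡 2) (x i), (∀ i, IsDominatedFrameAt f δ ℓ x e' u' i) ∧
      (∀ i, Tendsto (fun j => (⟨y j i, e j i⟩ : TangentBundle (𝓡 2) M)) l (𝓝 ⟨x i, e' i⟩)) ∧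
      ∀ i, Tendsto (fun j => (⟨y j i, u j i⟩ : TangentBundle (𝓡 2) M)) l (𝓝 ⟨x i, u' i⟩) := by
  choose e' he' using fun i => exists_tendsto_of_norm_le
    (F := EuclideanSpace ℝ (Fin 2)) (v := fun j => e j i) (hy i)
    ((h i).mono fun j hj => hj.norm_e.le)
  choose u' hu' using fun i => exists_tendsto_of_norm_le
    (F := EuclideanSpace ℝ (Fin 2)) (v := fun j => u j i) (hy i)
    ((h i).mono fun j hj => hj.norm_u.le)
  refine ⟨e', u', fun i => ⟨?_, ?_, ?_, ?_, ?_, ?_⟩, he', hu'⟩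
  · exact tendsto_nhds_unique (tendsto_norm_of_tendsto_mk (he' i))
      (tendsto_const_nhds.congr' ((h i).mono fun j hj => hj.norm_e.symm))
  · exact tendsto_nhds_unique (tendsto_norm_of_tendsto_mk (hu' i))
      (tendsto_const_nhds.congr' ((h i).mono fun j hj => hj.norm_u.symm))
  · exact le_of_tendsto ((tendsto_inner_of_tendsto_mk (he' i) (hu' i)).pow 2)
      ((h i).mono fun j hj => hj.inner_sq_le)
  · exact exists_limit_map_eq ((h i).mono fun j hj => hj.map_e)
      ((h (i + 1)).mono fun j hj => hj.norm_e) (he' i) (he' (i + 1))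
  · exact exists_limit_map_eq ((h i).mono fun j hj => hj.map_u)
      ((h (i + 1)).mono fun j hj => hj.norm_u) (hu' i) (hu' (i + 1))
  · have hn : ∀ (v : ∀ j, TangentSpace (𝓡 2) (y j i)) (v' : TangentSpace (𝓡 2) (x i)),
        Tendsto (fun j => (⟨y j i, v j⟩ : TangentBundle (𝓡 2) M)) l (𝓝 ⟨x i, v'⟩) →
        Tendsto (fun j => ‖derivIter f ℓ (y j i) (v j)‖) l (𝓝 ‖derivIter f ℓ (x i) v'‖) :=
      fun v v' hv => tendsto_norm_of_tendsto_mk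
        (((continuous_tangentMap_iterate f ℓ).tendsto _).comp hv)
    exact le_of_tendsto_of_tendsto (hn _ _ (he' i)) ((hn _ _ (hu' i)).const_mul _)
      ((h i).mono fun j hj => hj.dom)

end DominatedFrames

/-! ### The dominated splitting over the space of full orbits -/

section Extension

open Filter

variable {M : Type*} [TopologicalSpace M] [ChartedSpace (EuclideanSpace ℝ (Fin 2)) M]

theorem iterate_eq_of_orbit {f : End1 M} {x : ℤ → M} (hx : ∀ i, f (x i) = x (i + 1)) (i : ℤ)
    (n : ℕ) : f^[n] (x i) = x (i + n) := by
  induction n with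
  | zero => simp
  | succ n ih =>
    rw [Function.iterate_succ_apply', ih, hx, Nat.cast_succ, add_assoc]

/-- Every full orbit is a limit of shifts of a given dense forward orbit. The shifts are extended
to negative indices by a constant, which does not matter in the limit. -/
theorem mapClusterPt_forwardOrbit [T2Space M] {f : End1 M} {x₀ : M}
    (hdense : Dense (range (forwardOrbit f x₀))) {x : ℤ → M}
    (hx : ∀ i, f (x i) = x (i + 1)) :
    MapClusterPt x atTop (fun (n : ℕ) (i : ℤ) => forwardOrbit f x₀ (n + i).toNat) := by
  rw [mapClusterPt_iff_frequently]
  intro s hs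
  rw [nhds_pi, Filter.mem_pi] at hs
  obtain ⟨I, hI, t, ht, hts⟩ := hs
  obtain ⟨m, hm⟩ := hI.bddBelow
  set k : ℕ := (-m).toNat with hk
  have hO : ∀ᶠ y in 𝓝 (x (-k)), ∀ i ∈ I, f^[(i + k).toNat] y ∈ t i := by
    rw [Filter.eventually_all_finite hI]
    intro i hi
    refine (f.contMDiff.continuous.iterate _).continuousAt.eventually_mem ?_
    rw [iterate_eq_of_orbit hx]
    have h1 := hm hi
    rw [show (-k + ((i + k).toNat : ℤ) : ℤ) = i by omega]
    exact ht i
  obtain ⟨O, hOsub, hOo, hOx⟩ := eventually_nhds_iff.1 hO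
  rw [frequently_atTop]
  intro N
  obtain ⟨n, hn, hnO⟩ := exists_forwardOrbit_mem hdense hOo ⟨_, hOx⟩ N
  refine ⟨n + k, by omega, hts fun i hi => ?_⟩
  have h1 := hm hi
  have h2 := hOsub _ hnO i hi
  rw [← forwardOrbit_add] at h2
  rwa [show ((n + k : ℕ) + i : ℤ).toNat = n + (i + k).toNat by omega]

theorem tangentMap_iterate_forwardOrbit {f : End1 M} {x₀ : M}
    {e : ∀ n, TangentSpace (𝓡 2) (forwardOrbit f x₀ n)} {b : ℕ → ℝ} {n : ℕ}
    (h : ∀ m, n ≤ m → mfderiv (𝓡 2) (𝓡 2) f (forwardOrbit f x₀ m) (e m) = b m • e (m + 1))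
    (j : ℕ) : tangentMap (𝓡 2) (𝓡 2) (f^[j] : M → M) ⟨forwardOrbit f x₀ n, e n⟩ =
      ⟨forwardOrbit f x₀ (n + j), (∏ i ∈ Finset.Ico n (n + j), b i) • e (n + j)⟩ := by
  rw [tangentMap_iterate]
  induction j with
  | zero => simp
  | succ j ih =>
    have h1 : tangentMap (𝓡 2) (𝓡 2) f ⟨forwardOrbit f x₀ (n + j), e (n + j)⟩ =
        ⟨forwardOrbit f x₀ (n + (j + 1)), b (n + j) • e (n + (j + 1))⟩ :=
      congrArg (Bundle.TotalSpace.mk (f (forwardOrbit f x₀ (n + j)))) (h (n + j) (by omega))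
    have h2 : ∏ i ∈ Finset.Ico n (n + (j + 1)), b i =
        (∏ i ∈ Finset.Ico n (n + j), b i) * b (n + j) :=
      Finset.prod_Ico_succ_top (show n ≤ n + j by omega) b
    rw [Function.iterate_succ_apply', ih, tangentMap_smul_of_eq h1, smul_smul, h2]

theorem mfderiv_eq_smul_of_shift {f : End1 M} {x : OrbitSpace f} {v : ∀ i, TangentSpace (𝓡 2) (x.1 i)}
    {v' w : TangentSpace (𝓡 2) ((shift f x).1 0)} {b c : ℝ}
    (hmap : tangentMap (𝓡 2) (𝓡 2) f ⟨x.1 0, v 0⟩ = ⟨x.1 (0 + 1), b • v (0 + 1)⟩)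
    (hv' : (⟨(shift f x).1 0, v'⟩ : TangentBundle (𝓡 2) M) = ⟨x.1 (0 + 1), v (0 + 1)⟩)
    (hw : v' = c • w) : mfderiv (𝓡 2) (𝓡 2) f (x.1 0) (v 0) = (b * c) • w := by
  have h1 : (⟨(shift f x).1 0, b • v'⟩ : TangentBundle (𝓡 2) M) =
      ⟨x.1 (0 + 1), b • v (0 + 1)⟩ :=
    congrArg (fun p : TangentBundle (𝓡 2) M => (⟨p.1, b • p.2⟩ : TangentBundle (𝓡 2) M)) hv'
  have h2 := hmap.trans h1.symm
  unfold tangentMap at h2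
  rw [Bundle.TotalSpace.mk.injEq] at h2
  have h3 : mfderiv (𝓡 2) (𝓡 2) f (x.1 0) (v 0) = b • v' := eq_of_heq h2.2
  rw [h3, hw, mul_smul]

variable [Bundle.RiemannianBundle (fun x : M => TangentSpace (𝓡 2) x)]
  {f : End1 M} {δ : ℝ} {ℓ : ℕ}

theorem exists_shift_frame {x x' : ℤ → M} {e u : ∀ i, TangentSpace (𝓡 2) (x i)}
    (h : ∀ i, IsDominatedFrameAt f δ ℓ x e u i) (hx : ∀ i, x' i = x (i + 1)) :
    ∃ e' u' : ∀ i, TangentSpace (𝓡 2) (x' i), (∀ i, IsDominatedFrameAt f δ ℓ x' e' u' i) ∧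
      (∀ i, (⟨x' i, e' i⟩ : TangentBundle (𝓡 2) M) = ⟨x (i + 1), e (i + 1)⟩) ∧
      ∀ i, (⟨x' i, u' i⟩ : TangentBundle (𝓡 2) M) = ⟨x (i + 1), u (i + 1)⟩ := by
  obtain rfl : x' = fun i => x (i + 1) := funext hx
  exact ⟨fun i => e (i + 1), fun i => u (i + 1), fun i => ⟨(h (i + 1)).norm_e, (h (i + 1)).norm_u,
    (h (i + 1)).inner_sq_le, (h (i + 1)).map_e, (h (i + 1)).map_u, (h (i + 1)).dom⟩,
    fun _ => rfl, fun _ => rfl⟩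

/-- The field of lines spanned by the vectors `e x 0` of dominated frames is invariant: the frames
of the shifted orbit and the shifted frames span the same lines. -/
theorem exists_mfderiv_e_eq (hδ : 0 < δ) (hnz : ∀ n y, ∃ v, derivIter f n y v ≠ 0)
    {e u : ∀ (x : OrbitSpace f) (i : ℤ), TangentSpace (𝓡 2) (x.1 i)}
    (h : ∀ (x : OrbitSpace f) i, IsDominatedFrameAt f δ ℓ x.1 (e x) (u x) i) (x : OrbitSpace f) :
    ∃ c : ℝ, mfderiv (𝓡 2) (𝓡 2) f (x.1 0) (e x 0) = c • e (shift f x) 0 := by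
  obtain ⟨e', u', h', he', -⟩ := exists_shift_frame (h x) (shift_apply f x)
  obtain ⟨b, hb⟩ := (h x 0).map_e
  obtain ⟨c, hc⟩ := exists_eq_smul_e hδ hnz (h (shift f x)) h' 0
  exact ⟨b * c, mfderiv_eq_smul_of_shift hb (he' 0) hc⟩

theorem exists_mfderiv_u_eq (hδ : 0 < δ) (hℓ : 1 ≤ ℓ) (hnz : ∀ n y, ∃ v, derivIter f n y v ≠ 0)
    {e u : ∀ (x : OrbitSpace f) (i : ℤ), TangentSpace (𝓡 2) (x.1 i)}
    (h : ∀ (x : OrbitSpace f) i, IsDominatedFrameAt f δ ℓ x.1 (e x) (u x) i) (x : OrbitSpace f) :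
    ∃ c : ℝ, c ≠ 0 ∧ mfderiv (𝓡 2) (𝓡 2) f (x.1 0) (u x 0) = c • u (shift f x) 0 := by
  obtain ⟨e', u', h', -, hu'⟩ := exists_shift_frame (h x) (shift_apply f x)
  obtain ⟨b, hb⟩ := (h x 0).map_u
  obtain ⟨c, hc⟩ := exists_eq_smul_u hδ hnz h' (h (shift f x)) 0
  have hmap := mfderiv_eq_smul_of_shift hb (hu' 0) hc
  refine ⟨b * c, fun h0 => ?_, hmap⟩
  rw [h0, zero_smul] at hmap
  obtain ⟨k, rfl⟩ := Nat.exists_eq_succ_of_ne_zero (by omega : ℓ ≠ 0)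
  have hpos := norm_derivIter_pos hδ hnz (h x) 0 1
  rw [one_mul, derivIter_succ_apply, hmap] at hpos
  have h1 : derivIter f k (f (x.1 0)) (0 : TangentSpace (𝓡 2) (f (x.1 0))) = 0 := map_zero _
  have h2 : ‖derivIter f k (f (x.1 0)) (0 : TangentSpace (𝓡 2) (f (x.1 0)))‖ = 0 := by
    rw [h1, norm_zero]
  exact hpos.ne' h2

variable [IsManifold (𝓡 2) ∞ M] [IsContinuousRiemannianBundle (EuclideanSpace ℝ (Fin 2))
      (fun x : M => TangentSpace (𝓡 2) x)]

/-- A dominated frame along a dense forward orbit extends, by taking limits, to every full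
orbit. -/
theorem exists_frame_of_forwardOrbit [T2Space M] {x₀ : M}
    (hdense : Dense (range (forwardOrbit f x₀))) {N : ℕ}
    {e u : ∀ n, TangentSpace (𝓡 2) (forwardOrbit f x₀ n)} {a b : ℕ → ℝ}
    (h : ∀ n, N ≤ n → ‖e n‖ = 1 ∧ ‖u n‖ = 1 ∧ inner ℝ (e n) (u n) ^ 2 ≤ 1 - δ ^ 2 ∧
      mfderiv (𝓡 2) (𝓡 2) f (forwardOrbit f x₀ n) (e n) = b n • e (n + 1) ∧
      mfderiv (𝓡 2) (𝓡 2) f (forwardOrbit f x₀ n) (u n) = a n • u (n + 1) ∧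
      ∏ i ∈ Finset.Ico n (n + ℓ), |b i| ≤ 1 / 2 * ∏ i ∈ Finset.Ico n (n + ℓ), |a i|)
    {x : ℤ → M} (hx : ∀ i, f (x i) = x (i + 1)) :
    ∃ e' u' : ∀ i, TangentSpace (𝓡 2) (x i), ∀ i, IsDominatedFrameAt f δ ℓ x e' u' i := by
  obtain ⟨l, hl, hlx⟩ := mapClusterPt_iff_ultrafilter.1 (mapClusterPt_forwardOrbit hdense hx)
  have hev : ∀ i : ℤ, ∀ᶠ n : ℕ in l, IsDominatedFrameAt f δ ℓ
      (fun i => forwardOrbit f x₀ (n + i).toNat) (fun i => e (n + i).toNat)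
      (fun i => u (n + i).toNat) i := by
    intro i
    filter_upwards [hl (eventually_ge_atTop (N + i.natAbs))] with n hn
    have hk : N ≤ (n + i : ℤ).toNat := by omega
    obtain ⟨h1, h2, h3, h4, h5, h6⟩ := h _ hk
    have hsucc : (n + (i + 1) : ℤ).toNat = (n + i : ℤ).toNat + 1 := by omega
    refine ⟨h1, h2, h3, ⟨b (n + i : ℤ).toNat, ?_⟩, ⟨a (n + i : ℤ).toNat, ?_⟩, ?_⟩
    · rw [hsucc]
      exact congrArg (Bundle.TotalSpace.mk (f (forwardOrbit f x₀ (n + i : ℤ).toNat))) h4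
    · rw [hsucc]
      exact congrArg (Bundle.TotalSpace.mk (f (forwardOrbit f x₀ (n + i : ℤ).toNat))) h5
    · rw [norm_derivIter_eq_of_tangentMap_eq (tangentMap_iterate_forwardOrbit
          (fun m hm => (h m (hk.trans hm)).2.2.2.1) ℓ),
        norm_derivIter_eq_of_tangentMap_eq (tangentMap_iterate_forwardOrbit
          (fun m hm => (h m (hk.trans hm)).2.2.2.2.1) ℓ), norm_smul, norm_smul,
        (h _ (by omega)).1, (h _ (by omega)).2.1, mul_one, mul_one, Real.norm_eq_abs,
        Real.norm_eq_abs, Finset.abs_prod, Finset.abs_prod]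
      exact h6
  obtain ⟨e', u', h', -, -⟩ := exists_limit_frame (f := f) (δ := δ) (ℓ := ℓ) (l := l)
    (e := fun n i => e (n + i).toNat) (u := fun n i => u (n + i).toNat)
    (fun i => tendsto_pi_nhds.1 hlx i) hev
  exact ⟨e', u', h'⟩

/-- A field of lines spanned by unit vectors is continuous when all limits of these vectors stay
in the field. -/
theorem isLineSubbundle_of_limits
    {v : ∀ x : OrbitSpace f, TangentSpace (𝓡 2) (x.1 0)} (hv : ∀ x, ‖v x‖ = 1)
    (hlim : ∀ (x₁ : OrbitSpace f) (l : Ultrafilter (OrbitSpace f)), (l : Filter _) ≤ 𝓝 x₁ →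
      ∃ c : ℝ, Tendsto (fun x => (⟨x.1 0, v x⟩ : TangentBundle (𝓡 2) M)) l
        (𝓝 ⟨x₁.1 0, c • v x₁⟩)) :
    IsLineSubbundle f fun x => Submodule.span ℝ {v x} := by
  intro x₀
  set t := trivializationAt (EuclideanSpace ℝ (Fin 2)) (fun x : M => TangentSpace (𝓡 2) x)
    (x₀.1 0) with ht
  have hx₀ : x₀.1 0 ∈ t.baseSet := FiberBundle.mem_baseSet_trivializationAt' _
  have hproj : Continuous fun x : OrbitSpace f => x.1 0 :=
    (continuous_apply 0).comp continuous_subtype_val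
  -- a section of `TM` near `x₀ 0` extending `v x₀`
  let ξ : ∀ y : M, TangentSpace (𝓡 2) y := fun y => t.symm y (t ⟨x₀.1 0, v x₀⟩).2
  -- the component of `ξ` along the line does not depend on the choice of `±v x`
  let σ : ∀ x : OrbitSpace f, TangentSpace (𝓡 2) (x.1 0) := fun x =>
    inner ℝ (v x) (ξ (x.1 0)) • v x
  have hcont : ∀ x₁ : OrbitSpace f, x₁.1 0 ∈ t.baseSet → ContinuousAt
      (fun x => (⟨x.1 0, σ x⟩ : TangentBundle (𝓡 2) M)) x₁ := by
    intro x₁ hx₁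
    refine tendsto_iff_ultrafilter _ _ _ |>.2 fun l hl => ?_
    obtain ⟨c, hc⟩ := hlim x₁ l hl
    have hc1 : c * c = 1 := by
      have h1 := tendsto_nhds_unique (tendsto_norm_of_tendsto_mk hc)
        (tendsto_const_nhds.congr fun x => (hv x).symm)
      rw [norm_smul, hv, mul_one, Real.norm_eq_abs] at h1
      rw [← abs_mul_abs_self, h1, one_mul]
    have hξ : Tendsto (fun x : OrbitSpace f => (⟨x.1 0, ξ (x.1 0)⟩ : TangentBundle (𝓡 2) M)) l
        (𝓝 ⟨x₁.1 0, ξ (x₁.1 0)⟩) :=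
      tendsto_mk_symm (b := fun x : OrbitSpace f => x.1 0) hx₁
        ((hproj.tendsto x₁).mono_left hl) tendsto_const_nhds
    have h1 := tendsto_mk_smul (tendsto_inner_of_tendsto_mk hc hξ) hc
    have h2 : inner ℝ (c • v x₁) (ξ (x₁.1 0)) • c • v x₁ = σ x₁ := by
      rw [inner_smul_left, smul_smul, mul_right_comm]
      simp [hc1, σ]
    rw [h2] at h1
    exact h1
  have hσ₀ : σ x₀ = v x₀ := by
    have h1 : ξ (x₀.1 0) = v x₀ := t.symm_apply_apply_mk hx₀ _
    simp only [σ, h1]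
    rw [real_inner_self_eq_norm_sq, hv, one_pow, one_smul]
  have hU : ∀ᶠ x in 𝓝 x₀, x.1 0 ∈ t.baseSet ∧ σ x ≠ 0 := by
    refine ((hproj.tendsto x₀).eventually_mem (t.open_baseSet.mem_nhds hx₀)).and ?_
    have h1 : Tendsto (fun x => ‖σ x‖) (𝓝 x₀) (𝓝 ‖σ x₀‖) :=
      tendsto_norm_of_tendsto_mk (hcont x₀ hx₀)
    rw [hσ₀, hv] at h1
    filter_upwards [h1.eventually_const_lt one_pos] with x hx
    exact norm_pos_iff.1 hx
  refine ⟨_, hU, σ, fun x hx => (hcont x hx.1).continuousWithinAt, fun x hx => ⟨hx.2, ?_⟩⟩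
  have h1 : inner ℝ (v x) (ξ (x.1 0)) ≠ (0 : ℝ) := fun h0 => hx.2 (by simp only [σ, h0, zero_smul])
  exact (Submodule.span_singleton_smul_eq (IsUnit.mk0 _ h1) (v x)).symm

theorem isLineSubbundle_of_frames [T2Space M] (hδ : 0 < δ)
    (hnz : ∀ n y, ∃ v, derivIter f n y v ≠ 0)
    {e u : ∀ (x : OrbitSpace f) (i : ℤ), TangentSpace (𝓡 2) (x.1 i)}
    (h : ∀ (x : OrbitSpace f) i, IsDominatedFrameAt f δ ℓ x.1 (e x) (u x) i) :
    (IsLineSubbundle f fun x => Submodule.span ℝ {e x 0}) ∧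
      IsLineSubbundle f fun x => Submodule.span ℝ {u x 0} := by
  have hlim : ∀ (x₁ : OrbitSpace f) (l : Ultrafilter (OrbitSpace f)), (l : Filter _) ≤ 𝓝 x₁ →
      ∃ e' u' : ∀ i, TangentSpace (𝓡 2) (x₁.1 i),
        (∀ i, IsDominatedFrameAt f δ ℓ x₁.1 e' u' i) ∧
        (∀ i, Tendsto (fun x : OrbitSpace f => (⟨x.1 i, e x i⟩ : TangentBundle (𝓡 2) M)) l
          (𝓝 ⟨x₁.1 i, e' i⟩)) ∧
        ∀ i, Tendsto (fun x : OrbitSpace f => (⟨x.1 i, u x i⟩ : TangentBundle (𝓡 2) M)) l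
          (𝓝 ⟨x₁.1 i, u' i⟩) := fun x₁ l hl =>
    exists_limit_frame (fun i => (((continuous_apply i).comp
      continuous_subtype_val).tendsto x₁).mono_left hl) fun i => Eventually.of_forall fun x => h x i
  refine ⟨isLineSubbundle_of_limits (fun x => (h x 0).norm_e) fun x₁ l hl => ?_,
    isLineSubbundle_of_limits (fun x => (h x 0).norm_u) fun x₁ l hl => ?_⟩
  · obtain ⟨e', u', h', he', -⟩ := hlim x₁ l hl
    obtain ⟨c, hc⟩ := exists_eq_smul_e hδ hnz (h x₁) h' 0
    exact ⟨c, hc ▸ he' 0⟩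
  · obtain ⟨e', u', h', -, hu'⟩ := hlim x₁ l hl
    obtain ⟨c, hc⟩ := exists_eq_smul_u hδ hnz h' (h x₁) 0
    exact ⟨c, hc ▸ hu' 0⟩

end Extension

section Assembly

theorem isCompl_span_of_inner_sq_le {V : Type*} [NormedAddCommGroup V] [InnerProductSpace ℝ V]
    (hV : finrank ℝ V = 2) {e u : V} {δ : ℝ} (hδ : 0 < δ)
    (he : ‖e‖ = 1) (hu : ‖u‖ = 1) (heu : inner ℝ e u ^ 2 ≤ 1 - δ ^ 2) :
    IsCompl (Submodule.span ℝ {e}) (Submodule.span ℝ {u}) := by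
  refine ⟨(Submodule.disjoint_span_singleton' (norm_pos_iff.1 (by rw [hu]; exact one_pos))).2
    fun hmem => ?_, ?_⟩
  · obtain ⟨φ, hφu, hφe, -⟩ := exists_coord_norm_le hδ hu he (by rwa [real_inner_comm])
    obtain ⟨c, rfl⟩ := Submodule.mem_span_singleton.1 hmem
    rw [map_smul, hφe, smul_zero] at hφu
    exact zero_ne_one hφu
  · rw [codisjoint_iff, eq_top_iff]
    intro v _
    obtain ⟨p, q, rfl⟩ := exists_eq_smul_add_smul hV hδ he hu heu v
    exact Submodule.add_mem_sup (Submodule.smul_mem _ _ (Submodule.mem_span_singleton_self e))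
      (Submodule.smul_mem _ _ (Submodule.mem_span_singleton_self u))

theorem arccos_le_angle_of_inner_sq_le {V : Type*} [NormedAddCommGroup V]
    [InnerProductSpace ℝ V] {e u : V} {δ : ℝ} (he : ‖e‖ = 1) (hu : ‖u‖ = 1)
    (heu : inner ℝ e u ^ 2 ≤ 1 - δ ^ 2) {v w : V} (hv : v ∈ Submodule.span ℝ {e})
    (hw : w ∈ Submodule.span ℝ {u}) (hv0 : v ≠ 0) (hw0 : w ≠ 0) :
    Real.arccos √(1 - δ ^ 2) ≤ InnerProductGeometry.angle v w := by
  obtain ⟨p, rfl⟩ := Submodule.mem_span_singleton.1 hv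
  obtain ⟨q, rfl⟩ := Submodule.mem_span_singleton.1 hw
  have hp : 0 < |p| := abs_pos.2 fun h => hv0 (by rw [h, zero_smul])
  have hq : 0 < |q| := abs_pos.2 fun h => hw0 (by rw [h, zero_smul])
  refine Real.antitone_arccos ?_
  rw [norm_smul, norm_smul, he, hu, mul_one, mul_one, Real.norm_eq_abs, Real.norm_eq_abs,
    inner_smul_left, inner_smul_right, div_le_iff₀ (by positivity)]
  calc p * (q * inner ℝ e u) ≤ |p * (q * inner ℝ e u)| := le_abs_self _
    _ = |inner ℝ e u| * (|p| * |q|) := by rw [abs_mul, abs_mul]; ring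
    _ ≤ √(1 - δ ^ 2) * (|p| * |q|) := by
      gcongr
      exact Real.abs_le_sqrt heu

theorem norm_comp_subtypeL_le {V W : Type*} [NormedAddCommGroup V] [NormedSpace ℝ V]
    [NormedAddCommGroup W] [NormedSpace ℝ W] (L : V →L[ℝ] W) {e u : V} (he : ‖e‖ = 1)
    (hu : ‖u‖ = 1) (h : ‖L e‖ ≤ 1 / 2 * ‖L u‖) :
    ‖L.comp (Submodule.span ℝ {e}).subtypeL‖ ≤
      1 / 2 * ‖L.comp (Submodule.span ℝ {u}).subtypeL‖ := by
  have h1 : ‖L u‖ ≤ ‖L.comp (Submodule.span ℝ {u}).subtypeL‖ := by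
    have h2 := (L.comp (Submodule.span ℝ {u}).subtypeL).le_opNorm
      ⟨u, Submodule.mem_span_singleton_self u⟩
    simpa [hu] using h2
  refine ContinuousLinearMap.opNorm_le_bound _ (by positivity) ?_
  rintro ⟨v, hv⟩
  obtain ⟨c, rfl⟩ := Submodule.mem_span_singleton.1 hv
  change ‖L (c • e)‖ ≤ _ * ‖c • e‖
  rw [map_smul, norm_smul, norm_smul, he, mul_one, mul_comm]
  gcongr
  linarith

variable {M : Type*} [TopologicalSpace M] [ChartedSpace (EuclideanSpace ℝ (Fin 2)) M]
  [IsManifold (𝓡 2) ∞ M] [T2Space M]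
  [Bundle.RiemannianBundle (fun x : M => TangentSpace (𝓡 2) x)]
  [IsContinuousRiemannianBundle (EuclideanSpace ℝ (Fin 2)) (fun x : M => TangentSpace (𝓡 2) x)]
  {f : End1 M}

theorem hasDominatedSplitting_of_frames {δ : ℝ} {ℓ : ℕ} (hδ : 0 < δ) (hℓ : 1 ≤ ℓ)
    (hnz : ∀ n y, ∃ v, derivIter f n y v ≠ 0)
    {e u : ∀ (x : OrbitSpace f) (i : ℤ), TangentSpace (𝓡 2) (x.1 i)}
    (h : ∀ (x : OrbitSpace f) i, IsDominatedFrameAt f δ ℓ x.1 (e x) (u x) i) :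
    HasDominatedSplitting f := by
  refine ⟨Real.arccos √(1 - δ ^ 2), ℓ, fun x => Submodule.span ℝ {e x 0},
    fun x => Submodule.span ℝ {u x 0}, ?_, hℓ, (isLineSubbundle_of_frames hδ hnz h).1,
    (isLineSubbundle_of_frames hδ hnz h).2, fun x => ⟨?_, ?_, ?_, ?_, ?_⟩⟩
  · rw [Real.arccos_pos, Real.sqrt_lt' one_pos]
    linarith [sq_pos_of_pos hδ]
  · obtain ⟨c, hc⟩ := exists_mfderiv_e_eq hδ hnz h x
    rw [Submodule.map_span, image_singleton]
    refine (Submodule.span_singleton_le_iff_mem (p := Submodule.span ℝ {e (shift f x) 0}) _).2 ?_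
    exact Submodule.mem_span_singleton.2 ⟨c, hc.symm⟩
  · obtain ⟨c, hc0, hc⟩ := exists_mfderiv_u_eq hδ hℓ hnz h x
    rw [Submodule.map_span, image_singleton]
    refine Eq.trans ?_ (Submodule.span_singleton_smul_eq (IsUnit.mk0 c hc0) (u (shift f x) 0))
    exact congrArg (fun w : TangentSpace (𝓡 2) ((shift f x).1 0) => Submodule.span ℝ {w}) hc
  · exact isCompl_span_of_inner_sq_le (finrank_tangentSpace (x.1 0)) hδ (h x 0).norm_e
      (h x 0).norm_u (h x 0).inner_sq_le
  · exact fun v hv w hw hv0 hw0 => arccos_le_angle_of_inner_sq_le (h x 0).norm_e (h x 0).norm_u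
      (h x 0).inner_sq_le hv hw hv0 hw0
  · exact norm_comp_subtypeL_le (derivIter f ℓ (x.1 0)) (h x 0).norm_e (h x 0).norm_u (h x 0).dom

end Assembly

end SurfaceEndo

end

theorem mainTheorem2 {M : Type*} [TopologicalSpace M] [ChartedSpace (EuclideanSpace ℝ (Fin 2)) M]
    [IsManifold (𝓡 2) ∞ M] [CompactSpace M] [T2Space M]
    [Bundle.RiemannianBundle (fun x : M => TangentSpace (𝓡 2) x)]
    [IsContinuousRiemannianBundle (EuclideanSpace ℝ (Fin 2))
      (fun x : M => TangentSpace (𝓡 2) x)]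
    (f : SurfaceEndo.End1 M)
    (htrans : SurfaceEndo.IsTransitive f)
    (hcrit : (interior (SurfaceEndo.criticalSet f)).Nonempty)
    (hker : ∀ n : ℕ, 1 ≤ n → IsGreatest (Set.range (SurfaceEndo.kerDim f n)) 1) :
    SurfaceEndo.HasDominatedSplitting f ∨
      f ∈ closure {g : SurfaceEndo.End1 M | SurfaceEndo.HasFullDimensionalKernel g} := by
  by_cases hf : f ∈ closure {g : SurfaceEndo.End1 M | SurfaceEndo.HasFullDimensionalKernel g}
  · exact Or.inr hf
  left
  -- otherwise `f` itself has full-dimensional kernel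
  have hnz : ∀ n y, ∃ v, SurfaceEndo.derivIter f n y v ≠ 0 := by
    intro n y
    by_contra! h
    exact hf (subset_closure (SurfaceEndo.hasFullDimensionalKernel_of_forall h))
  obtain ⟨x₀, hx₀⟩ := htrans
  have hdense : Dense (Set.range (SurfaceEndo.forwardOrbit f x₀)) := by
    simpa only [← SurfaceEndo.forwardOrbit_eq_iterate] using hx₀
  obtain ⟨δ, hδ, hstab⟩ := SurfaceEndo.exists_stablyNonzero hf
    (SurfaceEndo.injective_forwardOrbit hdense)
  have hsing : ∀ N, ∃ n, N ≤ n ∧ ∃ v : TangentSpace (𝓡 2) (SurfaceEndo.forwardOrbit f x₀ n),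
      v ≠ 0 ∧ mfderiv (𝓡 2) (𝓡 2) f (SurfaceEndo.forwardOrbit f x₀ n) v = 0 := by
    intro N
    obtain ⟨n, hn, hmem⟩ := SurfaceEndo.exists_forwardOrbit_mem hdense isOpen_interior hcrit N
    exact ⟨n, hn, SurfaceEndo.exists_ne_zero_of_mem_criticalSet (interior_subset hmem)⟩
  obtain ⟨N, ℓ, e, u, a, b, hℓ, hframe⟩ := hstab.exists_dominated_frame hδ
    (fun n => SurfaceEndo.finrank_tangentSpace _) hsing
  choose e' u' h' using fun x : SurfaceEndo.OrbitSpace f =>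
    SurfaceEndo.exists_frame_of_forwardOrbit (δ := δ) (ℓ := ℓ) hdense hframe x.2
  exact SurfaceEndo.hasDominatedSplitting_of_frames hδ hℓ hnz h'
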